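/- **Setting.** Let $\ell_2$ be the real space of square-summable sequences. A *decentralized time-varying problem* $\mathcal{DP}$ with $n$ nodes consists of a sequence $(\mathcal G_k)_{k\ge1}$ of connected undirected graphs on $\{1,\dots,n\}$ and of convex functions $f_1,\dots,f_n:\ell_2\to\mathbb R$ with Lipschitz gradients, whose Fenchel conjugates $f_i^*$ are finite and differentiable everywhere. Put $f=\frac1n\sum_i f_i$. The problem is $L$-smooth, respectively $\mu$-strongly convex, if $f$ is. Let $\chi(\mathcal G)=\lambda_{\max}/\lambda_{\min}^+$ be the quotient of the largest and the smallest positive eigenvalue of the graph Laplacian, $\chi(\mathcal{DP})=\sup_k\chi(\mathcal G_k)$, and let $\Delta(\mathcal{DP})$ be the maximum over $k$ of the number of edges in which $\mathcal G_k$ and $\mathcal G_{k+1}$ differ. In an execution of a *first-order decentralized algorithm* started at $x_0=0$, node $i$ has local memory $\mathcal H_i(k)\subseteq\ell_2$ after $k$ time steps, $\mathcal H_i(0)=\{0\}$. Each time step is, for all nodes together, either a local computation, $\mathcal H_i(k+1)\subseteq\mathrm{span}\{x,\nabla f_i(x),\nabla f_i^*(x): x\in\mathcal H_i(k)\}$,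 or a communication round, $\mathcal H_i(k+1)\subseteq\mathrm{span}\bigcup_{j\in\mathcal N_i\cup\{i\}}\mathcal H_j(k)$, where $\mathcal N_i$ is the set of neighbours of $i$ in the current graph. The current graph is either (a) $\mathcal G_p$ at the $p$-th time step, or (b) $\mathcal G_r$ at the $r$-th communication round. **Theorem.** For every $\kappa_0>1$ there are constants $c>0$ and $\varepsilon_0\in(0,1)$, depending only on $\kappa_0$, such that for all $L\ge\mu>0$ with $L>10$ and all $M\in\mathbb R$ there is an $L$-smooth $\mu$-strongly convex decentralized problem with $n>M$ nodes, $\chi=\chi(\mathcal{DP})>M$ and $\Delta(\mathcal{DP})\le12\log_2 n$, whose minimizer $x_*$ of $f$ is not $x_0=0$, with the following properties. 1. For every execution of a first-order decentralized algorithm, every $p\ge0$, every node $i$ and every $x_p\in\mathcal H_i(p)$, under convention (a), $$\|x_p-x_*\|^2\ \ge\ \Bigl(\max\Bigl\{0,\,1-\sqrt{10}\sqrt{\mu/L}\Bigr\}\Bigr)^{\frac{12\log_2(\chi/2)\,p}{\chi}+2}\,\|x_0-x_*\|^2 .$$ Under convention (b) the same bound holds, even with $p$ in the exponent replaced by the number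 of communication rounds among the first $p$ time steps. 2. If $L/\mu\ge\kappa_0$, then, under convention (b), for every $\varepsilon\in(0,\varepsilon_0]$, in every execution in which the memory of some node contains after some number of time steps a point $x$ with $\|x-x_*\|^2\le\varepsilon\|x_0-x_*\|^2$, the number of communication rounds among these time steps is at least $$c\,\frac{\chi}{\log\chi}\,\sqrt{\frac L\mu}\,\log\frac1\varepsilon .$$ -/

import Mathlib

/-- The real Hilbert space `ℓ₂` of square-summable sequences. -/
abbrev EllTwo : Type := lp (fun _ : ℕ => ℝ) 2

/-- `h` is `L`-smooth: it is differentiable and its gradient is `L`-Lipschitz (the norm of the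
dual of a Hilbert space is the norm of the space, by the Riesz identification). -/
def IsSmooth (L : ℝ) (h : EllTwo → ℝ) : Prop :=
  Differentiable ℝ h ∧ ∀ x y : EllTwo, ‖gradient h y - gradient h x‖ ≤ L * ‖y - x‖

/-- `h` is differentiable and `μ`-strongly convex. -/
def IsStronglyConvex (μ : ℝ) (h : EllTwo → ℝ) : Prop :=
  Differentiable ℝ h ∧
    ∀ x y : EllTwo, h x + inner ℝ (gradient h x) (y - x) + μ / 2 * ‖y - x‖ ^ 2 ≤ h y

/-- The Fenchel conjugate `h*(y) = sup_x (⟨y, x⟩ - h(x))`. It is meaningful where the supremum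
is finite, see `HasRegularConjugate`. -/
noncomputable def fenchelConj (h : EllTwo → ℝ) (y : EllTwo) : ℝ :=
  sSup (Set.range fun x : EllTwo => inner ℝ y x - h x)

/-- The conjugate of `h` is finite and differentiable on the whole space, so that the dual
oracle `∇h*` is defined at every point. -/
def HasRegularConjugate (h : EllTwo → ℝ) : Prop :=
  (∀ y : EllTwo, BddAbove (Set.range fun x : EllTwo => inner ℝ y x - h x)) ∧
    Differentiable ℝ (fenchelConj h)

open Classical in
/-- The condition number `λ_max / λ_min⁺` of the Laplacian matrix `D(G) - A(G)`, the quotient of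
its largest eigenvalue and its smallest positive eigenvalue. -/
noncomputable def graphChi {n : ℕ} (G : SimpleGraph (Fin n)) : ℝ :=
  sSup (spectrum ℝ (G.lapMatrix ℝ)) / sInf (spectrum ℝ (G.lapMatrix ℝ) ∩ Set.Ioi 0)

/-- A decentralized time-varying problem with `n` nodes: a sequence of connected undirected
graphs on the nodes (`graph k` is the `(k+1)`-st graph of the sequence) and one objective
function per node. Every objective is convex and has a Lipschitz gradient, and its conjugate is
finite and differentiable, so that both oracles of the nodes are genuinely defined. -/
structure DecentralizedProblem (n : ℕ) where
  graph : ℕ → SimpleGraph (Fin n)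
  connected : ∀ k, (graph k).Connected
  f : Fin n → EllTwo → ℝ
  convex : ∀ i, ConvexOn ℝ Set.univ (f i)
  smooth : ∀ i, ∃ ℓ : ℝ, IsSmooth ℓ (f i)
  conj : ∀ i, HasRegularConjugate (f i)

namespace DecentralizedProblem

variable {n : ℕ}

/-- The global function `f = (1/n) ∑ f_i`. -/
noncomputable def globalFun (P : DecentralizedProblem n) (x : EllTwo) : ℝ :=
  (1 / (n : ℝ)) * ∑ i, P.f i x

/-- `χ = sup_k χ(G_k)`; there are finitely many graphs on `n` nodes, so this is a maximum. -/
noncomputable def chi (P : DecentralizedProblem n) : ℝ := ⨆ k, graphChi (P.graph k)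

/-- The number of edges that appear or disappear between the graphs of index `k` and `k + 1`. -/
noncomputable def edgeChange (P : DecentralizedProblem n) (k : ℕ) : ℕ :=
  (((P.graph k).edgeSet \ (P.graph (k + 1)).edgeSet) ∪
    ((P.graph (k + 1)).edgeSet \ (P.graph k).edgeSet)).ncard

/-- `Δ`, the maximal number of edges that change between consecutive graphs (the values are
bounded by the number of pairs of nodes, so this is a maximum). -/
noncomputable def maxEdgeChange (P : DecentralizedProblem n) : ℕ := ⨆ k, P.edgeChange k

end DecentralizedProblem

/-- The number of communication rounds among the first `k` time steps; `comm j = true` means that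
step `j` (that leads from time `j` to time `j + 1`) is a communication round. -/
def roundCount (comm : ℕ → Bool) (k : ℕ) : ℕ := Nat.count (fun j => comm j = true) k

/-- `H k i` is the local memory of node `i` at time `k` in an execution, started at `x₀ = 0`, of a
first-order decentralized algorithm on the problem `P`. Each step is either a local computation
at all nodes or a communication round; a communication round at step `k` takes place over the
graph of index `clock k`. -/
structure IsFirstOrderRun {n : ℕ} (P : DecentralizedProblem n) (comm : ℕ → Bool)
    (clock : ℕ → ℕ) (H : ℕ → Fin n → Set EllTwo) : Prop where
  init : ∀ i, H 0 i = {0}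
  compute : ∀ k, comm k = false → ∀ i, H (k + 1) i ⊆
    (Submodule.span ℝ
      (⋃ x ∈ H k i, {x, gradient (P.f i) x, gradient (fenchelConj (P.f i)) x}) : Set EllTwo)
  communicate : ∀ k, comm k = true → ∀ i, H (k + 1) i ⊆
    (Submodule.span ℝ
      (⋃ j ∈ {j | (P.graph (clock k)).Adj i j ∨ j = i}, H k j) : Set EllTwo)

/-- The factor `(max {0, 1 - √10 √(μ/L)}) ^ (12 log₂(χ/2) p / χ + 2)`. -/
noncomputable def rateBound (L μ χ : ℝ) (p : ℕ) : ℝ :=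
  (max 0 (1 - √10 * √(μ / L))) ^ (12 * Real.logb 2 (χ / 2) * (p : ℝ) / χ + 2)

/-! The objective is a chain quadratic on `ℓ₂` whose minimizer is `(1, q, q², …)` with `q = (√κ - 1)
/ (√κ + 1)`, `κ = L / μ`. Its coupling is split: the first node holds the linear term and the pairs
`(2j + 1, 2j + 2)`, the last node the pairs `(2j, 2j + 1)`, all other nodes a multiple of `‖x‖²`. A
memory inside `headSpace m` can therefore leave it by local computation only at the first node when
`m` is even and only at the last node when `m` is odd. The dual oracle gives no advantage: `W_π² =
I`, so the inverse of `s I - t W_π` is again a combination of `I` and `W_π`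
(`oracle_mem_headSpace`). New coordinates thus require information to travel from end to end, and a
point of `headSpace m` has squared distance at least `q ^ (2 m) ‖x_*‖²` from the minimizer
(`dist_geomVec_ge`).

The travel is slow although every graph has logarithmic diameter. Each graph consists of two binary
heaps, on the labels below and above a bridge node, joined only through that node. The bridge moves
by one label per clock tick, just ahead of the news, so news enters the far side one label at a time
and a crossing takes `T = n - 2` ticks (`level_step`, `sweepProblem_run_subset`). After `p` ticks at
most `p / T + 1` coordinates are known. Moving the bridge changes at most 8 edges.

Finally `χ` is of order `n`: degrees are bounded, a superharmonic potential gives a Poincaré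
constant linear in `n` (`heap_poincare`), and the cut at the bridge shows that this order is
attained. Hence `T ≥ χ / 384`, which is stronger than needed; the logarithms in the theorem serve
only to absorb constants, `χ` being chosen huge. -/

/-! ### Poincaré inequality on a binary heap -/

/-- A superharmonic potential on the binary heap with parent map `i ↦ i / 2`, vanishing at `0`. -/
noncomputable def heapPot (m : ℕ) : ℕ → ℝ
  | 0 => 0
  | (i + 1) => heapPot m ((i + 1) / 2) + (2 * m / ((i : ℝ) + 1) - 1)
decreasing_by omega

lemma heapPot_zero (m : ℕ) : heapPot m 0 = 0 := by rw [heapPot]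

lemma heapPot_of_pos (m : ℕ) {i : ℕ} (hi : 1 ≤ i) :
    heapPot m i = heapPot m (i / 2) + (2 * m / (i : ℝ) - 1) := by
  obtain ⟨j, rfl⟩ : ∃ j, i = j + 1 := ⟨i - 1, by omega⟩
  rw [heapPot]; push_cast; rfl

lemma one_le_heapSize {m i : ℕ} (hi : 1 ≤ i) (him : i ≤ m) : (1 : ℝ) ≤ 2 * m / (i : ℝ) - 1 := by
  have h1 : (0 : ℝ) < i := by exact_mod_cast hi
  have h2 : (i : ℝ) ≤ m := by exact_mod_cast him
  have : (2 : ℝ) ≤ 2 * m / i := by rw [le_div_iff₀ h1]; linarith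
  linarith

lemma heapPot_nonneg (m : ℕ) : ∀ i, i ≤ m → 0 ≤ heapPot m i := by
  intro i
  induction i using Nat.strong_induction_on with
  | _ i ih =>
    intro him
    rcases Nat.eq_zero_or_pos i with rfl | hi
    · rw [heapPot_zero]
    · rw [heapPot_of_pos m hi]
      have := ih (i / 2) (by omega) (by omega)
      have := one_le_heapSize hi him
      linarith

lemma heapPot_pos {m i : ℕ} (hi : 1 ≤ i) (him : i ≤ m) : 0 < heapPot m i := by
  rw [heapPot_of_pos m hi]
  have := heapPot_nonneg m (i / 2) (by omega)
  have := one_le_heapSize hi him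
  linarith

/-- The increments at least double towards the root, up to rounding, so their sum is geometric. The
correction `-2 / i` closes the induction, which then amounts to `3 / i ≤ 2 / (i / 2)`. -/
lemma heapPot_le_aux (m : ℕ) : ∀ i, 1 ≤ i → heapPot m i ≤ 2 * m * (3 - 2 / (i : ℝ)) := by
  intro i
  induction i using Nat.strong_induction_on with
  | _ i ih =>
    intro hi
    rw [heapPot_of_pos m hi]
    have hm : (0 : ℝ) ≤ m := Nat.cast_nonneg m
    rcases Nat.lt_or_ge i 2 with h | h
    · obtain rfl : i = 1 := by omega
      simp [heapPot_zero]; linarith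
    · have hj1 : 1 ≤ i / 2 := by omega
      have h1 := ih (i / 2) (by omega) hj1
      set j := i / 2 with hj
      have hj0 : (0 : ℝ) < j := by exact_mod_cast hj1
      have hi0 : (0 : ℝ) < i := by exact_mod_cast hi
      have hij : 2 * (j : ℝ) ≤ i := by exact_mod_cast (by omega : 2 * j ≤ i)
      have hij' : (i : ℝ) ≤ 2 * j + 1 := by exact_mod_cast (by omega : i ≤ 2 * j + 1)
      have hj1' : (1 : ℝ) ≤ j := by exact_mod_cast hj1
      have key : 3 / (i : ℝ) ≤ 2 / (j : ℝ) := by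
        rw [div_le_div_iff₀ hi0 hj0]; linarith
      have e : 2 * m / (i : ℝ) = 2 * m * (1 / i) := by ring
      have e3 : 3 / (i : ℝ) = 2 / i + 1 / i := by ring
      have : 2 * (m : ℝ) * (1 / i + 2 / i - 2 / j) ≤ 0 := by
        apply mul_nonpos_of_nonneg_of_nonpos (by positivity); linarith
      rw [e]; nlinarith

lemma heapPot_le (m : ℕ) {i : ℕ} (hi : 1 ≤ i) : heapPot m i ≤ 6 * m := by
  have h := heapPot_le_aux m i hi
  have hi0 : (0 : ℝ) < i := by exact_mod_cast hi
  have : (0 : ℝ) ≤ 2 * m * (2 / i) := by positivity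
  nlinarith

/-- Superharmonicity of `heapPot`: the increment `2m / i - 1` acts as an upper bound for the size of
the subtree at `i`, and a node exceeds its children together by at least one. -/
lemma sum_heap_children_le {m j : ℕ} (hj : 1 ≤ j) (hjm : j ≤ m) :
    ∑ i ∈ (Finset.range (m + 1)).filter (fun i => i / 2 = j), (2 * m / (i : ℝ) - 1)
      ≤ 2 * m / (j : ℝ) - 1 - 1 := by
  have hj0 : (0 : ℝ) < j := by exact_mod_cast hj
  have hm0 : (0 : ℝ) ≤ m := Nat.cast_nonneg m
  have hhalf : 2 * m / ((2 * j : ℕ) : ℝ) = m / j := by push_cast; field_simp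
  have hdbl : 2 * (m : ℝ) / j = m / j + m / j := by ring
  have hone : (1 : ℝ) ≤ m / j := by
    rw [le_div_iff₀ hj0]; rw [one_mul]; exact_mod_cast hjm
  rcases Nat.lt_or_ge m (2 * j) with h | h
  · rw [Finset.filter_eq_empty_iff.2 (by intro i hi; rw [Finset.mem_range] at hi; omega)]
    have := one_le_heapSize hj hjm
    simp only [Finset.sum_empty]; linarith
  rcases Nat.lt_or_ge m (2 * j + 1) with h' | h'
  · have : (Finset.range (m + 1)).filter (fun i => i / 2 = j) = {2 * j} := by
      ext i; simp only [Finset.mem_filter, Finset.mem_range, Finset.mem_singleton]; omega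
    rw [this, Finset.sum_singleton, hhalf, hdbl]; linarith
  · have : (Finset.range (m + 1)).filter (fun i => i / 2 = j) = {2 * j, 2 * j + 1} := by
      ext i
      simp only [Finset.mem_filter, Finset.mem_range, Finset.mem_insert, Finset.mem_singleton]
      omega
    rw [this, Finset.sum_pair (by omega), hhalf, hdbl]
    have : 2 * m / ((2 * j + 1 : ℕ) : ℝ) ≤ m / j := by
      rw [← hhalf]
      apply div_le_div_of_nonneg_left (by positivity) (by positivity)
      exact_mod_cast (by omega)
    linarith

/-- Picone's inequality on one edge, where the potential rises from `a` to `a + s`; the defect is a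
perfect square. -/
lemma edge_ge_of_pot {a s y z : ℝ} (ha : 0 < a) (hs : 0 ≤ s) :
    y ^ 2 / (a + s) * s - z ^ 2 / a * s ≤ (y - z) ^ 2 := by
  have has : 0 < a + s := by linarith
  have : (y - z) ^ 2 - (y ^ 2 / (a + s) * s - z ^ 2 / a * s)
      = (a * y - (a + s) * z) ^ 2 / (a * (a + s)) := by
    field_simp; ring
  have h2 : 0 ≤ (a * y - (a + s) * z) ^ 2 / (a * (a + s)) := by positivity
  linarith

/-- Poincaré inequality on the binary heap `1, …, m` with a Dirichlet condition above the root. -/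
lemma heap_poincare (m : ℕ) (y : ℕ → ℝ) (h0 : y 0 = 0) :
    ∑ i ∈ Finset.range (m + 1), y i ^ 2
      ≤ 6 * m * ∑ i ∈ Finset.range (m + 1), (y i - y (i / 2)) ^ 2 := by
  set G : ℕ → ℝ := fun i => y i ^ 2 / heapPot m i with hG
  set s : ℕ → ℝ := fun i => 2 * m / (i : ℝ) - 1 with hs
  have hG0 : G 0 = 0 := by simp [hG, h0]
  have hGn : ∀ i ∈ Finset.range (m + 1), 0 ≤ G i := fun i hi =>
    div_nonneg (sq_nonneg _) (heapPot_nonneg m i (by rw [Finset.mem_range] at hi; omega))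
  have h1 : ∀ i ∈ Finset.range (m + 1), G i * s i - G (i / 2) * s i ≤ (y i - y (i / 2)) ^ 2 := by
    intro i hi
    rw [Finset.mem_range] at hi
    rcases Nat.eq_zero_or_pos i with rfl | hpos
    · simp [hG0]
    have hs1 := one_le_heapSize hpos (by omega : i ≤ m)
    rcases Nat.lt_or_ge i 2 with h | h
    · obtain rfl : i = 1 := by omega
      have e : heapPot m 1 = s 1 := by
        rw [heapPot_of_pos m le_rfl]; simp [heapPot_zero, hs]
      have hne : s 1 ≠ 0 := by simp only [hs]; linarith
      simp only [hG, e]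
      simp [h0, div_mul_cancel₀ _ hne]
    · have := edge_ge_of_pot (y := y i) (z := y (i / 2)) (s := s i)
        (heapPot_pos (by omega : 1 ≤ i / 2) (by omega : i / 2 ≤ m)) (by linarith)
      rw [← heapPot_of_pos m hpos] at this
      exact this
  -- Grouping the edges by their upper end turns the subtracted terms into sums over children, which
  -- superharmonicity bounds; each node then keeps a surplus `G j`.
  have h2 : ∑ i ∈ Finset.range (m + 1), G (i / 2) * s i
      ≤ ∑ j ∈ Finset.range (m + 1), G j * (s j - 1) := by
    rw [← Finset.sum_fiberwise_of_maps_to (t := Finset.range (m + 1)) (g := fun i => i / 2)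
      (by intro i hi; rw [Finset.mem_range] at hi ⊢; omega)]
    apply Finset.sum_le_sum
    intro j hj
    have : ∑ i ∈ (Finset.range (m + 1)).filter (fun i => i / 2 = j), G (i / 2) * s i
        = G j * ∑ i ∈ (Finset.range (m + 1)).filter (fun i => i / 2 = j), s i := by
      rw [Finset.mul_sum]
      apply Finset.sum_congr rfl
      intro i hi
      rw [(Finset.mem_filter.1 hi).2]
    rw [this]
    rcases Nat.eq_zero_or_pos j with rfl | hpos
    · simp [hG0]
    · exact mul_le_mul_of_nonneg_left
        (sum_heap_children_le hpos (by rw [Finset.mem_range] at hj; omega)) (hGn j hj)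
  have h3 : ∑ i ∈ Finset.range (m + 1), G i
      ≤ ∑ i ∈ Finset.range (m + 1), (y i - y (i / 2)) ^ 2 := by
    have := Finset.sum_le_sum h1
    rw [Finset.sum_sub_distrib] at this
    have e : ∑ j ∈ Finset.range (m + 1), G j * (s j - 1)
        = ∑ j ∈ Finset.range (m + 1), G j * s j - ∑ j ∈ Finset.range (m + 1), G j := by
      rw [← Finset.sum_sub_distrib]; exact Finset.sum_congr rfl fun j _ => by ring
    linarith
  calc ∑ i ∈ Finset.range (m + 1), y i ^ 2
      ≤ ∑ i ∈ Finset.range (m + 1), 6 * m * G i := by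
        apply Finset.sum_le_sum
        intro i hi
        rw [Finset.mem_range] at hi
        rcases Nat.eq_zero_or_pos i with rfl | hpos
        · simp [h0, hG0]
        · have hp := heapPot_pos hpos (by omega : i ≤ m)
          have hle := heapPot_le m hpos
          simp only [hG]
          rw [mul_div_assoc', le_div_iff₀ hp]
          nlinarith [sq_nonneg (y i)]
    _ = 6 * m * ∑ i ∈ Finset.range (m + 1), G i := by rw [Finset.mul_sum]
    _ ≤ _ := by gcongr

/-! ### Graphs of parent maps -/

/-- The graph on `Fin n` in which every node is joined to its image under a parent map. -/
def parentGraph {n : ℕ} (p : Fin n → Fin n) : SimpleGraph (Fin n) :=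
  SimpleGraph.fromRel fun i j => p i = j

lemma parentGraph_adj {n : ℕ} (p : Fin n → Fin n) (i j : Fin n) :
    (parentGraph p).Adj i j ↔ i ≠ j ∧ (p i = j ∨ p j = i) := by
  simp [parentGraph, SimpleGraph.fromRel_adj]

lemma parentGraph_connected {n : ℕ} (p : Fin n → Fin n) (k : Fin n) (d : Fin n → ℕ)
    (h : ∀ i, i ≠ k → d (p i) < d i) : (parentGraph p).Connected := by
  have key : ∀ N, ∀ i, d i = N → (parentGraph p).Reachable i k := by
    intro N
    induction N using Nat.strong_induction_on with
    | _ N ih =>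
      intro i hi
      by_cases hik : i = k
      · rw [hik]
      · have h1 := h i hik
        have hne : i ≠ p i := fun e => by rw [← e] at h1; exact lt_irrefl _ h1
        have hadj : (parentGraph p).Adj i (p i) := (parentGraph_adj p _ _).2 ⟨hne, Or.inl rfl⟩
        exact hadj.reachable.trans (ih _ (hi ▸ h1) _ rfl)
  have : Nonempty (Fin n) := ⟨k⟩
  exact ⟨fun i j => (key _ i rfl).trans (key _ j rfl).symm⟩

lemma parentGraph_edgeSet_diff_subset {n : ℕ} (p p' : Fin n → Fin n) (D : Finset (Fin n))
    (hD : ∀ i, p i ≠ p' i → i ∈ D) :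
    (parentGraph p).edgeSet \ (parentGraph p').edgeSet ⊆ ↑(D.image fun i => s(i, p i)) := by
  rintro e ⟨he, he'⟩
  induction e using Sym2.ind with
  | _ i j =>
    rw [SimpleGraph.mem_edgeSet, parentGraph_adj] at he he'
    obtain ⟨hne, h | h⟩ := he
    · refine Finset.mem_coe.2 (Finset.mem_image.2 ⟨i, hD i fun e => he' ⟨hne, Or.inl ?_⟩, by rw [h]⟩)
      rw [← e, h]
    · refine Finset.mem_coe.2 (Finset.mem_image.2
        ⟨j, hD j fun e => he' ⟨hne, Or.inr ?_⟩, by rw [h, Sym2.eq_swap]⟩)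
      rw [← e, h]

/-- Each node whose parent changes loses at most one edge and gains at most one. -/
lemma parentGraph_edgeChange_le {n : ℕ} (p p' : Fin n → Fin n) (D : Finset (Fin n))
    (hD : ∀ i, p i ≠ p' i → i ∈ D) :
    (((parentGraph p).edgeSet \ (parentGraph p').edgeSet) ∪
      ((parentGraph p').edgeSet \ (parentGraph p).edgeSet)).ncard ≤ 2 * D.card := by
  have h1 := parentGraph_edgeSet_diff_subset p p' D hD
  have h2 := parentGraph_edgeSet_diff_subset p' p D fun i hi => hD i (Ne.symm hi)
  refine (Set.ncard_union_le _ _).trans ?_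
  have a1 := Set.ncard_le_ncard h1 (Finset.finite_toSet _)
  have a2 := Set.ncard_le_ncard h2 (Finset.finite_toSet _)
  rw [Set.ncard_coe_finset] at a1 a2
  have b1 : (D.image fun i => s(i, p i)).card ≤ D.card := Finset.card_image_le
  have b2 : (D.image fun i => s(i, p' i)).card ≤ D.card := Finset.card_image_le
  omega

/-! ### Laplacian spectrum and condition number -/

section Laplacian

open Classical in
lemma lapMatrix_form {n : ℕ} (G : SimpleGraph (Fin n)) (x : Fin n → ℝ) :
    x ⬝ᵥ (G.lapMatrix ℝ).mulVec x
      = (∑ i, ∑ j, if G.Adj i j then (x i - x j) ^ 2 else 0) / 2 := by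
  rw [← Matrix.toLinearMap₂'_apply', SimpleGraph.lapMatrix_toLinearMap₂']

open Classical in
-- The factor `1 / 2` is there because an edge is counted twice on the left when its ends are
-- parents of each other.
lemma parentGraph_form_ge {n : ℕ} (p : Fin n → Fin n) (x : Fin n → ℝ) :
    (∑ i, (x i - x (p i)) ^ 2) / 2 ≤ x ⬝ᵥ ((parentGraph p).lapMatrix ℝ).mulVec x := by
  rw [lapMatrix_form]
  gcongr with i
  calc (x i - x (p i)) ^ 2 ≤ if (parentGraph p).Adj i (p i) then (x i - x (p i)) ^ 2 else 0 := by
        split_ifs with h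
        · exact le_rfl
        · rw [parentGraph_adj] at h
          have : i = p i := by by_contra hne; exact h ⟨hne, Or.inl rfl⟩
          rw [← this]; simp
    _ ≤ _ := Finset.single_le_sum
        (f := fun j => if (parentGraph p).Adj i j then (x i - x j) ^ 2 else 0)
        (fun j _ => by split_ifs <;> positivity) (Finset.mem_univ (p i))

open Classical in
lemma parentGraph_form_le {n : ℕ} (p : Fin n → Fin n) (x : Fin n → ℝ) :
    x ⬝ᵥ ((parentGraph p).lapMatrix ℝ).mulVec x ≤ ∑ i, (x i - x (p i)) ^ 2 := by
  rw [lapMatrix_form]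
  have h : ∀ i j, (if (parentGraph p).Adj i j then (x i - x j) ^ 2 else 0)
      ≤ (if p i = j then (x i - x j) ^ 2 else 0) + (if p j = i then (x i - x j) ^ 2 else 0) := by
    intro i j
    have h0 : 0 ≤ (x i - x j) ^ 2 := sq_nonneg _
    split_ifs with h1 h2 h3 h3 <;> try linarith
    rw [parentGraph_adj] at h1
    tauto
  have h2 := Finset.sum_le_sum fun i (_ : i ∈ Finset.univ) =>
    Finset.sum_le_sum fun j (_ : j ∈ Finset.univ) => h i j
  simp only [Finset.sum_add_distrib] at h2
  rw [Finset.sum_comm (f := fun i j => if p j = i then (x i - x j) ^ 2 else 0)] at h2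
  simp only [Finset.sum_ite_eq, Finset.mem_univ, if_true] at h2
  have h3 : ∑ i, (x (p i) - x i) ^ 2 = ∑ i, (x i - x (p i)) ^ 2 :=
    Finset.sum_congr rfl fun i _ => by ring
  linarith

open Classical in
lemma exists_lapMatrix_eigenvector {n : ℕ} (G : SimpleGraph (Fin n)) {r : ℝ}
    (hr : r ∈ spectrum ℝ (G.lapMatrix ℝ)) :
    ∃ v : Fin n → ℝ, v ≠ 0 ∧ (G.lapMatrix ℝ).mulVec v = r • v := by
  rw [← Matrix.spectrum_toLin', ← Module.End.hasEigenvalue_iff_mem_spectrum] at hr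
  obtain ⟨v, hv⟩ := hr.exists_hasEigenvector
  exact ⟨v, hv.2, by simpa using hv.apply_eq_smul⟩

lemma dotProduct_self_pos' {n : ℕ} {v : Fin n → ℝ} (hv : v ≠ 0) : 0 < v ⬝ᵥ v := by
  have h0 : 0 ≤ v ⬝ᵥ v := Finset.sum_nonneg fun i _ => mul_self_nonneg _
  exact lt_of_le_of_ne h0 fun h => hv (dotProduct_self_eq_zero.1 h.symm)

open Classical in
lemma lapMatrix_mulVec_sum {n : ℕ} (G : SimpleGraph (Fin n)) (v : Fin n → ℝ) :
    ∑ i, (G.lapMatrix ℝ).mulVec v i = 0 := by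
  have h1 : (fun _ => (1 : ℝ)) ⬝ᵥ (G.lapMatrix ℝ).mulVec v = 0 := by
    rw [Matrix.dotProduct_mulVec, ← Matrix.mulVec_transpose, (G.isSymm_lapMatrix ℝ).eq,
      SimpleGraph.lapMatrix_mulVec_const_eq_zero, zero_dotProduct]
  simpa [dotProduct] using h1

open Classical in
lemma spectrum_lapMatrix_le {n : ℕ} (G : SimpleGraph (Fin n)) {a : ℝ}
    (ha : ∀ x : Fin n → ℝ, x ⬝ᵥ (G.lapMatrix ℝ).mulVec x ≤ a * (x ⬝ᵥ x)) {r : ℝ}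
    (hr : r ∈ spectrum ℝ (G.lapMatrix ℝ)) : r ≤ a := by
  obtain ⟨v, hv, e⟩ := exists_lapMatrix_eigenvector G hr
  have := ha v
  rw [e, dotProduct_smul, smul_eq_mul] at this
  exact le_of_mul_le_mul_right this (dotProduct_self_pos' hv)

open Classical in
lemma graphChi_le {n : ℕ} (G : SimpleGraph (Fin n)) {a b : ℝ} (ha0 : 0 ≤ a) (hb0 : 0 < b)
    (ha : ∀ x : Fin n → ℝ, x ⬝ᵥ (G.lapMatrix ℝ).mulVec x ≤ a * (x ⬝ᵥ x))
    (hb : ∀ x : Fin n → ℝ, ∑ i, x i = 0 → x ⬝ᵥ x ≤ b * (x ⬝ᵥ (G.lapMatrix ℝ).mulVec x)) :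
    graphChi G ≤ a * b := by
  -- Without positive eigenvalues the infimum is `0` by convention and so is the quotient.
  rcases (spectrum ℝ (G.lapMatrix ℝ) ∩ Set.Ioi 0).eq_empty_or_nonempty with h | h
  · unfold graphChi
    rw [h, Real.sInf_empty, div_zero]; positivity
  have h1 : sSup (spectrum ℝ (G.lapMatrix ℝ)) ≤ a :=
    csSup_le (h.mono Set.inter_subset_left) fun r hr => spectrum_lapMatrix_le G ha hr
  have h2 : 1 / b ≤ sInf (spectrum ℝ (G.lapMatrix ℝ) ∩ Set.Ioi 0) := by
    refine le_csInf h ?_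
    rintro r ⟨hr, hr0⟩
    rw [Set.mem_Ioi] at hr0
    obtain ⟨v, hv, e⟩ := exists_lapMatrix_eigenvector G hr
    have hs := lapMatrix_mulVec_sum G v
    rw [e] at hs
    simp only [Pi.smul_apply, smul_eq_mul, ← Finset.mul_sum] at hs
    have := hb v ((mul_eq_zero.1 hs).resolve_left hr0.ne')
    rw [e, dotProduct_smul, smul_eq_mul] at this
    have hp := dotProduct_self_pos' hv
    rw [div_le_iff₀ hb0]
    by_contra hlt
    push Not at hlt
    nlinarith
  have hpos : 0 < 1 / b := by positivity
  unfold graphChi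
  rw [div_le_iff₀ (hpos.trans_le h2)]
  rw [div_le_iff₀ hb0] at h2
  nlinarith

open Classical in
lemma exists_spectral_weights {n : ℕ} (A : Matrix (Fin n) (Fin n) ℝ) (hA : A.IsHermitian)
    (x : Fin n → ℝ) :
    ∃ (l : Fin n → ℝ) (u : Fin n → Fin n → ℝ),
      (∀ j, l j ∈ spectrum ℝ A) ∧ (∀ j, A.mulVec (u j) = l j • u j) ∧
      x ⬝ᵥ x = ∑ j, (u j ⬝ᵥ x) ^ 2 ∧ x ⬝ᵥ A.mulVec x = ∑ j, l j * (u j ⬝ᵥ x) ^ 2 := by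
  have hin : ∀ (y z : Fin n → ℝ),
      y ⬝ᵥ z = ∑ j, (hA.eigenvectorBasis j ⬝ᵥ y) * (hA.eigenvectorBasis j ⬝ᵥ z) := by
    intro y z
    have := hA.eigenvectorBasis.sum_inner_mul_inner (WithLp.toLp 2 y) (WithLp.toLp 2 z)
    simp only [EuclideanSpace.inner_eq_star_dotProduct, star_trivial] at this
    rw [dotProduct_comm y z, ← this]
    exact Finset.sum_congr rfl fun j _ => by
      rw [dotProduct_comm z]
  refine ⟨hA.eigenvalues, fun j => hA.eigenvectorBasis j, hA.eigenvalues_mem_spectrum_real,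
    hA.mulVec_eigenvectorBasis, ?_, ?_⟩
  · rw [hin x x]; exact Finset.sum_congr rfl fun j _ => by ring
  · rw [hin x (A.mulVec x)]
    refine Finset.sum_congr rfl fun j _ => ?_
    have hT : A.transpose = A := by
      rw [← Matrix.conjTranspose_eq_transpose_of_trivial]; exact hA
    rw [Matrix.dotProduct_mulVec, ← Matrix.mulVec_transpose, hT, hA.mulVec_eigenvectorBasis,
      smul_dotProduct, smul_eq_mul]
    ring

open Classical in
-- In an eigenbasis the Rayleigh quotient averages the eigenvalues with weights `(u j ⬝ᵥ x)²`.
-- Eigenvectors without positive eigenvalue are constant by connectedness, hence have weight zero as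
-- `x` has mean zero.
lemma exists_eigenvalue_le_rayleigh {n : ℕ} (G : SimpleGraph (Fin n)) (hG : G.Connected)
    (x : Fin n → ℝ) (hx : x ≠ 0) (hs : ∑ i, x i = 0) :
    ∃ r ∈ spectrum ℝ (G.lapMatrix ℝ) ∩ Set.Ioi 0,
      r * (x ⬝ᵥ x) ≤ x ⬝ᵥ (G.lapMatrix ℝ).mulVec x := by
  obtain ⟨l, u, hl, hu, h1, h2⟩ :=
    exists_spectral_weights (G.lapMatrix ℝ) (G.isHermitian_lapMatrix ℝ) x
  by_contra! hcon
  have hN := dotProduct_self_pos' hx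
  set N := x ⬝ᵥ x
  set Q := x ⬝ᵥ (G.lapMatrix ℝ).mulVec x
  have hpt : ∀ j, u j ⬝ᵥ x = 0 ∨ Q < l j * N := by
    intro j
    rcases lt_or_ge 0 (l j) with hpos | hneg
    · exact Or.inr (hcon _ ⟨hl j, hpos⟩)
    left
    have hform := lapMatrix_form G (u j)
    rw [hu j, dotProduct_smul, smul_eq_mul] at hform
    have hnn : 0 ≤ (∑ i, ∑ k, if G.Adj i k then (u j i - u j k) ^ 2 else 0) / 2 := by positivity
    have hzero : l j * (u j ⬝ᵥ u j) = 0 := by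
      refine le_antisymm (mul_nonpos_of_nonpos_of_nonneg hneg ?_) (hform ▸ hnn)
      exact Finset.sum_nonneg fun i _ => mul_self_nonneg _
    have hker : (G.lapMatrix ℝ).mulVec (u j) = 0 := by
      rcases mul_eq_zero.1 hzero with h | h
      · rw [hu j, h, zero_smul]
      · rw [dotProduct_self_eq_zero.1 h, Matrix.mulVec_zero]
    rw [SimpleGraph.lapMatrix_mulVec_eq_zero_iff_forall_reachable] at hker
    obtain ⟨i0⟩ := hG.nonempty
    have : ∀ i, u j i = u j i0 := fun i => hker i i0 (hG.preconnected i i0)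
    simp only [dotProduct, this, ← Finset.mul_sum, hs, mul_zero]
  have hle : ∀ j ∈ Finset.univ, Q * (u j ⬝ᵥ x) ^ 2 ≤ N * (l j * (u j ⬝ᵥ x) ^ 2) := by
    intro j _
    rcases hpt j with h | h
    · rw [h]; simp
    · nlinarith [sq_nonneg (u j ⬝ᵥ x)]
  have hex : ∃ j ∈ Finset.univ, Q * (u j ⬝ᵥ x) ^ 2 < N * (l j * (u j ⬝ᵥ x) ^ 2) := by
    by_contra! hno
    have : N = 0 := by
      rw [h1]
      refine Finset.sum_eq_zero fun j _ => ?_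
      rcases hpt j with h | h
      · rw [h]; simp
      · have := hno j (Finset.mem_univ j)
        by_contra hne
        have : 0 < (u j ⬝ᵥ x) ^ 2 := lt_of_le_of_ne (sq_nonneg _) (Ne.symm hne)
        nlinarith
    exact hN.ne' this
  have := Finset.sum_lt_sum hle hex
  rw [← Finset.mul_sum, ← Finset.mul_sum, ← h1, ← h2] at this
  linarith [mul_comm Q N]

open Classical in
lemma exists_rayleigh_le_eigenvalue {n : ℕ} (G : SimpleGraph (Fin n))
    (x : Fin n → ℝ) (hx : x ≠ 0) :
    ∃ r ∈ spectrum ℝ (G.lapMatrix ℝ),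
      x ⬝ᵥ (G.lapMatrix ℝ).mulVec x ≤ r * (x ⬝ᵥ x) := by
  obtain ⟨l, u, hl, hu, h1, h2⟩ :=
    exists_spectral_weights (G.lapMatrix ℝ) (G.isHermitian_lapMatrix ℝ) x
  have hne : (Finset.univ : Finset (Fin n)).Nonempty := by
    by_contra h
    rw [Finset.not_nonempty_iff_eq_empty] at h
    exact (dotProduct_self_pos' hx).ne' (by rw [h1, h, Finset.sum_empty])
  obtain ⟨j, _, hj⟩ := Finset.exists_max_image Finset.univ l hne
  refine ⟨l j, hl j, ?_⟩
  rw [h2, h1, Finset.mul_sum]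
  exact Finset.sum_le_sum fun i hi => mul_le_mul_of_nonneg_right (hj i hi) (sq_nonneg _)

open Classical in
lemma le_graphChi {n : ℕ} (G : SimpleGraph (Fin n)) (hG : G.Connected) {a c d : ℝ} (hd : 0 ≤ d)
    (ha : ∀ x : Fin n → ℝ, x ⬝ᵥ (G.lapMatrix ℝ).mulVec x ≤ a * (x ⬝ᵥ x))
    (x : Fin n → ℝ) (hx : x ≠ 0) (hs : ∑ i, x i = 0)
    (hxc : x ⬝ᵥ (G.lapMatrix ℝ).mulVec x ≤ c * (x ⬝ᵥ x))
    (z : Fin n → ℝ) (hz : z ≠ 0) (hzd : d * (z ⬝ᵥ z) ≤ z ⬝ᵥ (G.lapMatrix ℝ).mulVec z) :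
    d / c ≤ graphChi G := by
  obtain ⟨r, hr, hr1⟩ := exists_eigenvalue_le_rayleigh G hG x hx hs
  obtain ⟨t, ht, ht1⟩ := exists_rayleigh_le_eigenvalue G z hz
  have hrc : r ≤ c := le_of_mul_le_mul_right (hr1.trans hxc) (dotProduct_self_pos' hx)
  have hdt : d ≤ t := le_of_mul_le_mul_right (hzd.trans ht1) (dotProduct_self_pos' hz)
  have h1 : t ≤ sSup (spectrum ℝ (G.lapMatrix ℝ)) :=
    le_csSup ⟨a, fun _ h => spectrum_lapMatrix_le G ha h⟩ ht
  have h2 : sInf (spectrum ℝ (G.lapMatrix ℝ) ∩ Set.Ioi 0) ≤ r :=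
    csInf_le ⟨0, fun _ h => h.2.le⟩ hr
  -- Finiteness makes the infimum an attained positive eigenvalue, so it is nonzero.
  have hfin : (spectrum ℝ (G.lapMatrix ℝ) ∩ Set.Ioi 0).Finite :=
    (Matrix.finite_real_spectrum).subset Set.inter_subset_left
  have h3 : 0 < sInf (spectrum ℝ (G.lapMatrix ℝ) ∩ Set.Ioi 0) :=
    (Set.Nonempty.csInf_mem ⟨r, hr⟩ hfin).2
  unfold graphChi
  exact div_le_div₀ (hd.trans (hdt.trans h1)) (hdt.trans h1) h3 (h2.trans hrc)

end Laplacian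

/-! ### The tree with a movable bridge -/

/-- Parent map on `{0, …, n - 1}`: the bridge `k` is the root with children `0` and `n - 1`; the
nodes below `k` form a binary heap rooted at `0`, those above `k` a mirrored heap rooted at
`n - 1`. -/
def bridgeParNat (n k i : ℕ) : ℕ :=
  if i = k ∨ i = 0 ∨ i + 1 = n then k
  else if i < k then (i + 1) / 2 - 1 else n - (n - i) / 2

lemma bridgeParNat_lt {n k i : ℕ} (hk : k < n) (hi : i < n) : bridgeParNat n k i < n := by
  unfold bridgeParNat; split_ifs <;> omega

/-- The parent map `bridgeParNat` on `Fin n`. -/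
def bridgePar {n : ℕ} (k i : Fin n) : Fin n := ⟨bridgeParNat n k i, bridgeParNat_lt k.2 i.2⟩

/-- The tree of two binary heaps whose roots `0` and `n - 1` are joined through the node `k`. -/
def bridgeGraph {n : ℕ} (k : Fin n) : SimpleGraph (Fin n) := parentGraph (bridgePar k)

lemma bridgePar_val {n : ℕ} (k i : Fin n) : (bridgePar k i : ℕ) = bridgeParNat n k i := rfl

lemma bridgeGraph_connected {n : ℕ} (k : Fin n) : (bridgeGraph k).Connected := by
  -- The decreasing quantity is the one-based heap index on either side, which passing to the parent
  -- halves, with `0` at the bridge.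
  refine parentGraph_connected _ k
    (fun i => if i = k then 0 else if i < k then i + 1 else n - i) ?_
  intro i hik
  simp only [Fin.ext_iff, Fin.lt_def, bridgePar_val] at hik ⊢
  have := i.2
  have := k.2
  unfold bridgeParNat
  split_ifs <;> omega

lemma bridgeGraph_not_adj {n : ℕ} {k i j : Fin n} (hj : j < k) (hi : k < i) :
    ¬ (bridgeGraph k).Adj i j := by
  rw [bridgeGraph, parentGraph_adj]
  simp only [Fin.ext_iff, Fin.lt_def, bridgePar_val] at hj hi ⊢
  have := i.2
  unfold bridgeParNat
  split_ifs <;> omega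

lemma bridgeGraph_edgeChange_le {n : ℕ} (k k' : Fin n) (h : (k' : ℕ) ≤ k + 1)
    (h' : (k : ℕ) ≤ k' + 1) :
    (((bridgeGraph k).edgeSet \ (bridgeGraph k').edgeSet) ∪
      ((bridgeGraph k').edgeSet \ (bridgeGraph k).edgeSet)).ncard ≤ 8 := by
  -- Only the two heap roots and the two bridge positions can change parent: no label lies strictly
  -- between `k` and `k'`.
  set D : Finset (Fin n) :=
    Finset.univ.filter fun i => (i : ℕ) ∈ ({0, n - 1, (k : ℕ), (k' : ℕ)} : Finset ℕ) with hDdef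
  have hcard : D.card ≤ 4 :=
    (Finset.card_le_card_of_injOn (fun i : Fin n => (i : ℕ))
      (fun i hi => (Finset.mem_filter.1 hi).2) (fun a _ b _ h => Fin.ext h)).trans
      Finset.card_le_four
  have := parentGraph_edgeChange_le (bridgePar k) (bridgePar k') D (by
    intro i hi
    rw [hDdef, Finset.mem_filter]
    refine ⟨Finset.mem_univ _, ?_⟩
    simp only [Finset.mem_insert, Finset.mem_singleton]
    by_contra hno
    apply hi
    rw [Fin.ext_iff, bridgePar_val, bridgePar_val]
    have := i.2
    have := k.2
    have := k'.2
    unfold bridgeParNat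
    split_ifs <;> omega)
  exact this.trans (by omega)

lemma bridge_energy_le {n : ℕ} (k : Fin n) (x : Fin n → ℝ) :
    ∑ i, (x i - x (bridgePar k i)) ^ 2 ≤ 16 * (x ⬝ᵥ x) := by
  have h1 : ∑ i, x (bridgePar k i) ^ 2 ≤ 7 * ∑ j, x j ^ 2 := by
    rw [← Finset.sum_fiberwise (g := bridgePar k), Finset.mul_sum]
    refine Finset.sum_le_sum fun j _ => ?_
    have e : ∑ i ∈ Finset.univ.filter (fun i => bridgePar k i = j), x (bridgePar k i) ^ 2
        = ∑ i ∈ Finset.univ.filter (fun i => bridgePar k i = j), x j ^ 2 :=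
      Finset.sum_congr rfl fun i hi => by rw [(Finset.mem_filter.1 hi).2]
    rw [e, Finset.sum_const, nsmul_eq_mul]
    refine mul_le_mul_of_nonneg_right ?_ (sq_nonneg _)
    -- A node has at most seven preimages: the bridge, the two roots, two heap children and two
    -- mirrored heap children. The final constant is `2 + 2 * 7 = 16`.
    have hc : (Finset.univ.filter (fun i => bridgePar k i = j)).card
        ≤ (insert (k : ℕ) ({0, n - 1, 2 * (j : ℕ) + 1, 2 * (j : ℕ) + 2, n - 2 * (n - j),
          n - 2 * (n - j) - 1} : Finset ℕ)).card := by
      refine Finset.card_le_card_of_injOn (fun i : Fin n => (i : ℕ)) ?_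
        (fun a _ b _ h => Fin.ext h)
      intro i hi
      have hi' := (Finset.mem_filter.1 hi).2
      rw [Fin.ext_iff, bridgePar_val] at hi'
      simp only [Finset.coe_insert, Finset.coe_singleton, Set.mem_insert_iff,
        Set.mem_singleton_iff]
      have := i.2
      have := j.2
      unfold bridgeParNat at hi'
      split_ifs at hi' <;> omega
    have := (hc.trans (Finset.card_insert_le _ _)).trans (Nat.succ_le_succ Finset.card_le_six)
    exact_mod_cast this
  have h2 : ∑ i, (x i - x (bridgePar k i)) ^ 2
      ≤ ∑ i, (2 * x i ^ 2 + 2 * x (bridgePar k i) ^ 2) :=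
    Finset.sum_le_sum fun i _ => by nlinarith [sq_nonneg (x i + x (bridgePar k i))]
  rw [Finset.sum_add_distrib, ← Finset.mul_sum, ← Finset.mul_sum] at h2
  have h3 : x ⬝ᵥ x = ∑ j, x j ^ 2 := Finset.sum_congr rfl fun j _ => by ring
  rw [h3]; linarith

/-- Index `0` above the root plays the bridge, where the function has the value `c`; subtracting `c`
gives the Dirichlet condition. -/
lemma heap_poincare_shift (m : ℕ) (z : ℕ → ℝ) (c : ℝ) :
    ∑ h ∈ Finset.range m, (z (h + 1) - c) ^ 2
      ≤ 6 * m * ∑ h ∈ Finset.range m,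
        (z (h + 1) - if h = 0 then c else z ((h + 1) / 2)) ^ 2 := by
  have := heap_poincare m (fun h => if h = 0 then 0 else z h - c) (by simp)
  rw [Finset.sum_range_succ', Finset.sum_range_succ'] at this
  simp only [Nat.add_eq_zero_iff, one_ne_zero, and_false, if_false, if_true, Nat.zero_div, sub_self,
    ne_eq, OfNat.ofNat_ne_zero, not_false_eq_true, zero_pow, add_zero] at this
  refine this.trans (le_of_eq ?_)
  congr 1
  refine Finset.sum_congr rfl fun h _ => ?_
  congr 1
  rcases Nat.eq_zero_or_pos h with rfl | hp
  · simp
  · rw [if_neg (by omega), if_neg (by omega)]; ring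

lemma bridge_poincare_nat {n k : ℕ} (hk : k < n) (X : ℕ → ℝ) :
    ∑ i ∈ Finset.range n, (X i - X k) ^ 2
      ≤ 6 * n * ∑ i ∈ Finset.range n, (X i - X (bridgeParNat n k i)) ^ 2 := by
  obtain ⟨l, rfl⟩ : ∃ l, n = k + 1 + l := ⟨n - (k + 1), by omega⟩
  have hlow := heap_poincare_shift k (fun h => X (h - 1)) (X k)
  have hup := heap_poincare_shift l (fun h => X (k + 1 + l - h)) (X k)
  have e1 : ∑ h ∈ Finset.range k,
      (X (h + 1 - 1) - if h = 0 then X k else X ((h + 1) / 2 - 1)) ^ 2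
      = ∑ i ∈ Finset.range k, (X i - X (bridgeParNat (k + 1 + l) k i)) ^ 2 := by
    refine Finset.sum_congr rfl fun i hi => ?_
    rw [Finset.mem_range] at hi
    unfold bridgeParNat
    split_ifs <;> first | rfl | omega
  -- In the mirrored heap the one-based index of a label is its distance to `n`, so the sum has to
  -- be reflected.
  have e2 : ∑ h ∈ Finset.range l, (X (k + 1 + l - (h + 1)) -
        if h = 0 then X k else X (k + 1 + l - (h + 1) / 2)) ^ 2
      = ∑ i ∈ Finset.range l, (X (k + 1 + i) - X (bridgeParNat (k + 1 + l) k (k + 1 + i))) ^ 2 := by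
    rw [← Finset.sum_range_reflect]
    refine Finset.sum_congr rfl fun i hi => ?_
    rw [Finset.mem_range] at hi
    have a1 : k + 1 + l - (l - 1 - i + 1) = k + 1 + i := by omega
    have a2 : (l - 1 - i + 1) = (k + 1 + l - (k + 1 + i)) := by omega
    rw [a1, a2]
    unfold bridgeParNat
    split_ifs <;> first | rfl | omega
  have e3 : ∑ h ∈ Finset.range l, (X (k + 1 + l - (h + 1)) - X k) ^ 2
      = ∑ i ∈ Finset.range l, (X (k + 1 + i) - X k) ^ 2 := by
    rw [← Finset.sum_range_reflect]
    refine Finset.sum_congr rfl fun i hi => ?_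
    rw [Finset.mem_range] at hi
    have a1 : k + 1 + l - (l - 1 - i + 1) = k + 1 + i := by omega
    rw [a1]
  rw [e1] at hlow
  rw [e2, e3] at hup
  simp only [Nat.add_sub_cancel] at hlow
  rw [Finset.sum_range_add, Finset.sum_range_succ, Finset.sum_range_add, Finset.sum_range_succ,
    sub_self]
  set A := ∑ i ∈ Finset.range k, (X i - X (bridgeParNat (k + 1 + l) k i)) ^ 2
  set B := ∑ i ∈ Finset.range l, (X (k + 1 + i) - X (bridgeParNat (k + 1 + l) k (k + 1 + i))) ^ 2
  have hA : 0 ≤ A := Finset.sum_nonneg fun _ _ => sq_nonneg _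
  have hB : 0 ≤ B := Finset.sum_nonneg fun _ _ => sq_nonneg _
  have hk0 : (0 : ℝ) ≤ k := Nat.cast_nonneg k
  have hl0 : (0 : ℝ) ≤ l := Nat.cast_nonneg l
  have hs : 0 ≤ (X k - X (bridgeParNat (k + 1 + l) k k)) ^ 2 := sq_nonneg _
  push_cast
  nlinarith [mul_nonneg hk0 hA, mul_nonneg hk0 hB, mul_nonneg hl0 hA, mul_nonneg hl0 hB,
    mul_nonneg hk0 hs, mul_nonneg hl0 hs]

lemma bridge_poincare {n : ℕ} (k : Fin n) (x : Fin n → ℝ) :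
    ∑ i, (x i - x k) ^ 2 ≤ 6 * n * ∑ i, (x i - x (bridgePar k i)) ^ 2 := by
  set X : ℕ → ℝ := fun i => if h : i < n then x ⟨i, h⟩ else 0 with hX
  have hx : ∀ i : Fin n, x i = X i := fun i => by simp [hX]
  simp only [hx, bridgePar_val]
  rw [Fin.sum_univ_eq_sum_range (fun i => (X i - X k) ^ 2),
    Fin.sum_univ_eq_sum_range (fun i => (X i - X (bridgeParNat n k i)) ^ 2)]
  exact bridge_poincare_nat k.2 X

open Classical in
lemma bridge_form_le {n : ℕ} (k : Fin n) (x : Fin n → ℝ) :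
    x ⬝ᵥ ((bridgeGraph k).lapMatrix ℝ).mulVec x ≤ 16 * (x ⬝ᵥ x) :=
  (parentGraph_form_le _ x).trans (bridge_energy_le k x)

lemma bridge_graphChi_le {n : ℕ} (k : Fin n) : graphChi (bridgeGraph k) ≤ 192 * n := by
  classical
  have hn : (0 : ℝ) < n := by exact_mod_cast k.pos
  have := graphChi_le (bridgeGraph k) (a := 16) (b := 12 * n) (by norm_num) (by positivity)
    (bridge_form_le k) (by
      intro x hs
      have h1 := bridge_poincare k x
      have h2 := parentGraph_form_ge (bridgePar k) x
      -- For a vector of mean zero, `0` is the best centre, so replacing it by `x k` only increases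
      -- the sum of squares.
      have h3 : x ⬝ᵥ x ≤ ∑ i, (x i - x k) ^ 2 := by
        have : ∑ i, (x i - x k) ^ 2 = x ⬝ᵥ x - 2 * x k * ∑ i, x i + n * x k ^ 2 := by
          rw [dotProduct, Finset.mul_sum, ← Finset.sum_sub_distrib]
          have : (n : ℝ) * x k ^ 2 = ∑ i : Fin n, x k ^ 2 := by simp
          rw [this, ← Finset.sum_add_distrib]
          exact Finset.sum_congr rfl fun i _ => by ring
        rw [this, hs]
        have : 0 ≤ (n : ℝ) * x k ^ 2 := by positivity
        linarith
      have h4 : 12 * (n : ℝ) * ((∑ i, (x i - x (bridgePar k i)) ^ 2) / 2)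
          ≤ 12 * n * (x ⬝ᵥ ((bridgeGraph k).lapMatrix ℝ).mulVec x) :=
        mul_le_mul_of_nonneg_left h2 (by positivity)
      linarith)
  linarith

/-- With the bridge in the middle, the vector equal to `1` below it and `-1` above it has norm
squared `2m` and pays only for the two bridge edges, so `λ_min⁺ ≤ 1 / m`. A unit vector at node `0`
gives `λ_max ≥ 1 / 2`. -/
lemma le_bridge_graphChi {m : ℕ} (hm : 1 ≤ m) (k : Fin (2 * m + 1)) (hk : (k : ℕ) = m) :
    (m : ℝ) / 2 ≤ graphChi (bridgeGraph k) := by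
  classical
  have hm0 : (0 : ℝ) < m := by exact_mod_cast hm
  set S : ℕ → ℝ := fun i => if i < m then 1 else if i = m then 0 else -1 with hS
  set x : Fin (2 * m + 1) → ℝ := fun i => S i with hxdef
  have split : ∀ g : ℕ → ℝ, ∑ i : Fin (2 * m + 1), g i
      = ∑ i ∈ Finset.range m, g i + g m + ∑ i ∈ Finset.range m, g (m + 1 + i) := by
    intro g
    rw [Fin.sum_univ_eq_sum_range, show 2 * m + 1 = m + 1 + m by ring, Finset.sum_range_add,
      Finset.sum_range_succ]
  have low : ∀ i ∈ Finset.range m, S i = 1 := fun i hi => by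
    rw [Finset.mem_range] at hi; simp [hS, hi]
  have mid : S m = 0 := by simp [hS]
  have up : ∀ i ∈ Finset.range m, S (m + 1 + i) = -1 := fun i _ => by
    simp only [hS]; rw [if_neg (by omega), if_neg (by omega)]
  have hsum : ∑ i, x i = 0 := by
    rw [split S, Finset.sum_congr rfl low, Finset.sum_congr rfl up, mid]; simp
  have hnorm : x ⬝ᵥ x = 2 * m := by
    change ∑ i : Fin (2 * m + 1), S i * S i = _
    have low2 : ∀ i ∈ Finset.range m, S i * S i = 1 := fun i hi => by rw [low i hi, one_mul]
    have up2 : ∀ i ∈ Finset.range m, S (m + 1 + i) * S (m + 1 + i) = 1 := fun i hi => by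
      rw [up i hi]; norm_num
    rw [split fun i => S i * S i, mid, Finset.sum_congr rfl low2, Finset.sum_congr rfl up2]
    simp; ring
  have hx0 : x ≠ 0 := fun h => by
    rw [h, dotProduct_zero] at hnorm
    linarith
  have henergy : ∑ i, (x i - x (bridgePar k i)) ^ 2 ≤ 2 := by
    have : ∀ i : Fin (2 * m + 1), (x i - x (bridgePar k i)) ^ 2
        ≤ (if i = 0 then 1 else 0) + (if i = Fin.last (2 * m) then 1 else 0) := by
      intro i
      simp only [hxdef, bridgePar_val, Fin.ext_iff, Fin.val_zero, Fin.val_last, hk, hS]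
      have := i.2
      unfold bridgeParNat
      split_ifs <;> first | (exfalso; omega) | norm_num
    refine (Finset.sum_le_sum fun i _ => this i).trans (le_of_eq ?_)
    rw [Finset.sum_add_distrib, Finset.sum_ite_eq' , Finset.sum_ite_eq']
    norm_num
  set z : Fin (2 * m + 1) → ℝ := Pi.single 0 1 with hz
  have hzz : z ⬝ᵥ z = 1 := by simp [hz]
  have hz0 : z ≠ 0 := fun h => by
    rw [h, dotProduct_zero] at hzz
    norm_num at hzz
  have hzE : (1 : ℝ) ≤ ∑ i, (z i - z (bridgePar k i)) ^ 2 := by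
    have h0 : bridgePar k 0 ≠ 0 := by
      rw [Ne, Fin.ext_iff, bridgePar_val]
      simp only [Fin.val_zero, hk]
      unfold bridgeParNat
      rw [if_pos (by simp)]; omega
    have h1 : (z 0 - z (bridgePar k 0)) ^ 2 = 1 := by simp [hz, h0]
    rw [← h1]
    exact Finset.single_le_sum (f := fun i => (z i - z (bridgePar k i)) ^ 2)
      (fun i _ => sq_nonneg _) (Finset.mem_univ 0)
  have := le_graphChi (bridgeGraph k) (bridgeGraph_connected k) (a := 16) (c := 1 / m) (d := 1 / 2)
    (by norm_num) (bridge_form_le k) x hx0 hsum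
    (by
      refine (parentGraph_form_le _ x).trans (henergy.trans (le_of_eq ?_))
      rw [hnorm]; field_simp)
    z hz0 (by
      rw [hzz]
      have := parentGraph_form_ge (bridgePar k) z
      exact le_trans (by linarith) this)
  refine le_trans (le_of_eq ?_) this
  field_simp

/-! ### Quadratic functions on `ℓ₂` and their conjugates -/

/-- The quadratic function `x ↦ ½ ⟨A x, x⟩ - ⟨b, x⟩ + c`. -/
noncomputable def quad (A : EllTwo →L[ℝ] EllTwo) (b : EllTwo) (c : ℝ) (x : EllTwo) : ℝ :=
  1 / 2 * inner ℝ (A x) x - inner ℝ b x + c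

/-- Self-adjointness of an operator, in the form `⟨A x, y⟩ = ⟨x, A y⟩`. -/
def IsSelfAdjOp (A : EllTwo →L[ℝ] EllTwo) : Prop := ∀ x y : EllTwo, inner ℝ (A x) y = inner ℝ x (A y)

lemma quad_expand {A : EllTwo →L[ℝ] EllTwo} (hA : IsSelfAdjOp A) (b : EllTwo) (c : ℝ)
    (x y : EllTwo) :
    quad A b c y
      = quad A b c x + inner ℝ (A x - b) (y - x) + 1 / 2 * inner ℝ (A (y - x)) (y - x) := by
  have h := hA x y
  have h2 : inner ℝ (A y) x = inner ℝ (A x) y := by rw [hA y x, real_inner_comm]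
  simp only [quad, map_sub, inner_sub_left, inner_sub_right, h2]
  ring

lemma quad_hasGradientAt {A : EllTwo →L[ℝ] EllTwo} (hA : IsSelfAdjOp A) (b : EllTwo) (c : ℝ)
    (x : EllTwo) : HasGradientAt (quad A b c) (A x - b) x := by
  rw [hasGradientAt_iff_hasFDerivAt]
  have h1 := ((A.hasFDerivAt (x := x)).inner ℝ (hasFDerivAt_id x)).const_mul (1 / 2 : ℝ)
  have h2 := (hasFDerivAt_const b x).inner ℝ (hasFDerivAt_id x)
  have h3 := (h1.sub h2).add_const c
  refine h3.congr_fderiv ?_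
  ext v
  simp [fderivInnerCLM_apply]
  rw [hA v x, real_inner_comm (A x) v]
  ring

lemma quad_gradient {A : EllTwo →L[ℝ] EllTwo} (hA : IsSelfAdjOp A) (b : EllTwo) (c : ℝ)
    (x : EllTwo) : gradient (quad A b c) x = A x - b :=
  (quad_hasGradientAt hA b c x).gradient

lemma quad_differentiable {A : EllTwo →L[ℝ] EllTwo} (hA : IsSelfAdjOp A) (b : EllTwo) (c : ℝ) :
    Differentiable ℝ (quad A b c) :=
  fun x => (quad_hasGradientAt hA b c x).differentiableAt

lemma quad_isSmooth {A : EllTwo →L[ℝ] EllTwo} (hA : IsSelfAdjOp A) (b : EllTwo) (c : ℝ) {L : ℝ}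
    (hL : ‖A‖ ≤ L) : IsSmooth L (quad A b c) := by
  refine ⟨quad_differentiable hA b c, fun x y => ?_⟩
  rw [quad_gradient hA, quad_gradient hA, sub_sub_sub_cancel_right, ← map_sub]
  exact (A.le_opNorm _).trans (mul_le_mul_of_nonneg_right hL (norm_nonneg _))

lemma quad_isStronglyConvex {A : EllTwo →L[ℝ] EllTwo} (hA : IsSelfAdjOp A) (b : EllTwo) (c : ℝ)
    {μ : ℝ} (hμ : ∀ x : EllTwo, μ * ‖x‖ ^ 2 ≤ inner ℝ (A x) x) :
    IsStronglyConvex μ (quad A b c) := by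
  refine ⟨quad_differentiable hA b c, fun x y => ?_⟩
  rw [quad_gradient hA, quad_expand hA b c x y]
  have := hμ (y - x)
  linarith

lemma quad_convexOn {A : EllTwo →L[ℝ] EllTwo} (hA : IsSelfAdjOp A) (b : EllTwo) (c : ℝ)
    (hpos : ∀ x : EllTwo, 0 ≤ inner ℝ (A x) x) : ConvexOn ℝ Set.univ (quad A b c) := by
  refine ⟨convex_univ, fun x _ y _ s t hs ht hst => ?_⟩
  set z := s • x + t • y with hz
  have hx := quad_expand hA b c z x
  have hy := quad_expand hA b c z y
  have hlin : s * inner ℝ (A z - b) (x - z) + t * inner ℝ (A z - b) (y - z) = 0 := by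
    rw [← real_inner_smul_right, ← real_inner_smul_right, ← inner_add_right]
    have : s • (x - z) + t • (y - z) = 0 := by
      have : s • (x - z) + t • (y - z) = (s • x + t • y) - (s + t) • z := by module
      rw [this, hst, one_smul, ← hz, sub_self]
    rw [this, inner_zero_right]
  have p1 := mul_nonneg hs (hpos (x - z))
  have p2 := mul_nonneg ht (hpos (y - z))
  simp only [smul_eq_mul]
  rw [hx, hy]
  have : s * quad A b c z + t * quad A b c z = quad A b c z := by rw [← add_mul, hst, one_mul]
  nlinarith

lemma quad_isMinOn {A : EllTwo →L[ℝ] EllTwo} (hA : IsSelfAdjOp A) (b : EllTwo) (c : ℝ)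
    (hpos : ∀ x : EllTwo, 0 ≤ inner ℝ (A x) x) {z : EllTwo} (hz : A z = b) :
    IsMinOn (quad A b c) Set.univ z := by
  intro y _
  have := quad_expand hA b c z y
  rw [hz, sub_self, inner_zero_left] at this
  have := hpos (y - z)
  change quad A b c z ≤ quad A b c y
  linarith

/-- Completing the square about the maximizer `B (y + b)`. -/
lemma quad_conj_isGreatest {A B : EllTwo →L[ℝ] EllTwo} (hA : IsSelfAdjOp A) (hB : IsSelfAdjOp B)
    (b : EllTwo) (c : ℝ) (hpos : ∀ x : EllTwo, 0 ≤ inner ℝ (A x) x) (hAB : ∀ x, A (B x) = x)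
    (y : EllTwo) :
    IsGreatest (Set.range fun x : EllTwo => inner ℝ y x - quad A b c x)
      (quad B (-(B b)) (1 / 2 * inner ℝ (B b) b - c) y) := by
  have key : ∀ x, inner ℝ y x - quad A b c x = quad B (-(B b)) (1 / 2 * inner ℝ (B b) b - c) y
      - 1 / 2 * inner ℝ (A (x - B (y + b))) (x - B (y + b)) := by
    intro x
    have h := quad_expand hA b c (B (y + b)) x
    rw [h, hAB]
    have e1 : inner ℝ (B b) y = inner ℝ (B y) b := by rw [hB b y, real_inner_comm]
    have e2 : inner ℝ y (B y) = inner ℝ (B y) y := real_inner_comm _ _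
    have e3 : inner ℝ y (B b) = inner ℝ (B y) b := by rw [real_inner_comm, e1]
    have e4 : inner ℝ b (B y) = inner ℝ (B y) b := real_inner_comm _ _
    have e5 : inner ℝ b (B b) = inner ℝ (B b) b := real_inner_comm _ _
    simp only [quad, hAB]
    simp only [map_add, inner_add_left, inner_add_right, inner_sub_right, inner_neg_left,
      add_sub_cancel_right, e1, e2, e3, e4, e5]
    ring
  refine ⟨⟨B (y + b), ?_⟩, ?_⟩
  · simp only [key, sub_self, inner_zero_right, mul_zero, sub_zero]
  · rintro _ ⟨x, rfl⟩
    simp only [key]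
    have := hpos (x - B (y + b))
    linarith

lemma quad_fenchelConj {A B : EllTwo →L[ℝ] EllTwo} (hA : IsSelfAdjOp A) (hB : IsSelfAdjOp B)
    (b : EllTwo) (c : ℝ) (hpos : ∀ x : EllTwo, 0 ≤ inner ℝ (A x) x) (hAB : ∀ x, A (B x) = x) :
    fenchelConj (quad A b c) = quad B (-(B b)) (1 / 2 * inner ℝ (B b) b - c) :=
  funext fun y => (quad_conj_isGreatest hA hB b c hpos hAB y).csSup_eq

lemma quad_hasRegularConjugate {A B : EllTwo →L[ℝ] EllTwo} (hA : IsSelfAdjOp A) (hB : IsSelfAdjOp B)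
    (b : EllTwo) (c : ℝ) (hpos : ∀ x : EllTwo, 0 ≤ inner ℝ (A x) x) (hAB : ∀ x, A (B x) = x) :
    HasRegularConjugate (quad A b c) := by
  refine ⟨fun y => (quad_conj_isGreatest hA hB b c hpos hAB y).bddAbove, ?_⟩
  rw [quad_fenchelConj hA hB b c hpos hAB]
  exact quad_differentiable hB _ _

/-! ### Coordinate involutions and head spaces -/

lemma memℓp_comp_perm (π : Equiv.Perm ℕ) (x : EllTwo) :
    Memℓp (fun i => x (π i)) (2 : ENNReal) := by
  have h := lp.memℓp x
  have h2 : 0 < (2 : ENNReal).toReal := by norm_num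
  rw [memℓp_gen_iff h2] at h ⊢
  exact (Equiv.summable_iff π).2 h

/-- The permutation of coordinates `(x_i) ↦ (x_{π i})` as an operator on `ℓ₂`. -/
noncomputable def permOp (π : Equiv.Perm ℕ) : EllTwo →L[ℝ] EllTwo :=
  LinearMap.mkContinuous
    { toFun := fun x => ⟨fun i => x (π i), memℓp_comp_perm π x⟩
      map_add' := fun _ _ => rfl
      map_smul' := fun _ _ => rfl } 1 (by
    intro x
    have h2 : 0 < (2 : ENNReal).toReal := by norm_num
    rw [one_mul, lp.norm_eq_tsum_rpow h2, lp.norm_eq_tsum_rpow h2]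
    refine le_of_eq ?_
    congr 1
    exact Equiv.tsum_eq π fun i => ‖x i‖ ^ (2 : ENNReal).toReal)

lemma permOp_apply (π : Equiv.Perm ℕ) (x : EllTwo) (i : ℕ) : permOp π x i = x (π i) := rfl

lemma permOp_norm_le (π : Equiv.Perm ℕ) : ‖permOp π‖ ≤ 1 :=
  LinearMap.mkContinuous_norm_le _ zero_le_one _

lemma permOp_involutive {π : Equiv.Perm ℕ} (hπ : Function.Involutive π) (x : EllTwo) :
    permOp π (permOp π x) = x := by
  ext i
  rw [permOp_apply, permOp_apply, hπ i]

lemma permOp_isSelfAdjOp {π : Equiv.Perm ℕ} (hπ : Function.Involutive π) : IsSelfAdjOp (permOp π) := by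
  intro x y
  rw [lp.inner_eq_tsum, lp.inner_eq_tsum, ← Equiv.tsum_eq π]
  refine tsum_congr fun i => ?_
  rw [permOp_apply, permOp_apply, hπ i]

lemma permOp_inner_le (π : Equiv.Perm ℕ) (x : EllTwo) : inner ℝ (permOp π x) x ≤ ‖x‖ ^ 2 := by
  refine (real_inner_le_norm _ _).trans ?_
  have := (permOp π).le_of_opNorm_le (permOp_norm_le π) x
  nlinarith [norm_nonneg x]

/-- The operator `s I - t W_π`. -/
noncomputable def mixOp (s t : ℝ) (π : Equiv.Perm ℕ) : EllTwo →L[ℝ] EllTwo :=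
  s • ContinuousLinearMap.id ℝ EllTwo - t • permOp π

lemma mixOp_apply (s t : ℝ) (π : Equiv.Perm ℕ) (x : EllTwo) :
    mixOp s t π x = s • x - t • permOp π x := rfl

lemma mixOp_isSelfAdjOp (s t : ℝ) {π : Equiv.Perm ℕ} (hπ : Function.Involutive π) :
    IsSelfAdjOp (mixOp s t π) := by
  intro x y
  simp only [mixOp_apply, inner_sub_left, inner_sub_right, real_inner_smul_left,
    real_inner_smul_right, permOp_isSelfAdjOp hπ x y]

lemma mixOp_inner_nonneg {s t : ℝ} (ht : 0 ≤ t) (hts : t ≤ s) (π : Equiv.Perm ℕ) (x : EllTwo) :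
    0 ≤ inner ℝ (mixOp s t π x) x := by
  rw [mixOp_apply, inner_sub_left, real_inner_smul_left, real_inner_smul_left,
    real_inner_self_eq_norm_sq]
  have := permOp_inner_le π x
  nlinarith [sq_nonneg ‖x‖]

/-- From `W² = I` follows `(s I - t W)(s I + t W) = (s² - t²) I`. -/
lemma mixOp_inverse {s t : ℝ} (ht : 0 ≤ t) (hts : t < s) {π : Equiv.Perm ℕ}
    (hπ : Function.Involutive π) (x : EllTwo) :
    mixOp s t π (mixOp (s / (s ^ 2 - t ^ 2)) (-t / (s ^ 2 - t ^ 2)) π x) = x := by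
  have hne : s ^ 2 - t ^ 2 ≠ 0 := by nlinarith
  simp only [mixOp_apply, map_sub, map_smul, permOp_involutive hπ]
  have : s * (s / (s ^ 2 - t ^ 2)) - t * (t / (s ^ 2 - t ^ 2)) = 1 := by field_simp
  calc _ = (s * (s / (s ^ 2 - t ^ 2)) - t * (t / (s ^ 2 - t ^ 2))) • x := by module
    _ = x := by rw [this, one_smul]

/-- The vectors of `ℓ₂` supported on the first `m` coordinates. -/
def headSpace (m : ℕ) : Submodule ℝ EllTwo where
  carrier := {x | ∀ j, m ≤ j → x j = 0}
  add_mem' {x y} hx hy j hj := by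
    change x j + y j = 0
    rw [hx j hj, hy j hj, add_zero]
  zero_mem' _ _ := rfl
  smul_mem' c x hx j hj := by
    change c * x j = 0
    rw [hx j hj, mul_zero]

lemma headSpace_mono {m m' : ℕ} (h : m ≤ m') : headSpace m ≤ headSpace m' :=
  fun _ hx j hj => hx j (h.trans hj)

lemma mixOp_mem_headSpace (s t : ℝ) {π : Equiv.Perm ℕ} {m : ℕ} (hm : t = 0 ∨ ∀ j, m ≤ j → m ≤ π j)
    {x : EllTwo} (hx : x ∈ headSpace m) : mixOp s t π x ∈ headSpace m := by
  rw [mixOp_apply]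
  refine Submodule.sub_mem _ (Submodule.smul_mem _ _ hx) ?_
  rcases hm with rfl | hm
  · rw [zero_smul]; exact Submodule.zero_mem _
  · exact Submodule.smul_mem _ _ fun j hj => hx _ (hm j hj)

/-- Both oracles of the function `½ ⟨(s I - t W_π) x, x⟩ - ⟨b, x⟩` preserve `headSpace m` when
`π` preserves `{0, …, m - 1}` and `b` lies in `headSpace m`. -/
lemma oracle_mem_headSpace {s t : ℝ} (ht : 0 ≤ t) (hts : t < s) {π : Equiv.Perm ℕ}
    (hπ : Function.Involutive π) {m : ℕ} (hm : t = 0 ∨ ∀ j, m ≤ j → m ≤ π j) {b : EllTwo}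
    (hb : b ∈ headSpace m) {x : EllTwo} (hx : x ∈ headSpace m) :
    gradient (quad (mixOp s t π) b 0) x ∈ headSpace m ∧
      gradient (fenchelConj (quad (mixOp s t π) b 0)) x ∈ headSpace m := by
  have hm' : -t / (s ^ 2 - t ^ 2) = 0 ∨ ∀ j, m ≤ j → m ≤ π j :=
    hm.imp_left fun h => by rw [h, neg_zero, zero_div]
  constructor
  · rw [quad_gradient (mixOp_isSelfAdjOp s t hπ)]
    exact Submodule.sub_mem _ (mixOp_mem_headSpace s t hm hx) hb
  · rw [quad_fenchelConj (mixOp_isSelfAdjOp s t hπ) (mixOp_isSelfAdjOp _ _ hπ) b 0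
      (mixOp_inner_nonneg ht hts.le π) (mixOp_inverse ht hts hπ),
      quad_gradient (mixOp_isSelfAdjOp _ _ hπ), sub_neg_eq_add]
    exact Submodule.add_mem _ (mixOp_mem_headSpace _ _ hm' hx) (mixOp_mem_headSpace _ _ hm' hb)

lemma evenSwap_involutive : Function.Involutive fun i : ℕ => if i % 2 = 0 then i + 1 else i - 1 := by
  intro i
  grind

lemma oddSwap_involutive : Function.Involutive fun i : ℕ =>
    if i = 0 then 0 else if i % 2 = 1 then i + 1 else i - 1 := by
  intro i
  grind

/-- The involution `2 i ↔ 2 i + 1`. -/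
def evenSwap : Equiv.Perm ℕ := evenSwap_involutive.toPerm

/-- The involution `2 i + 1 ↔ 2 i + 2`, fixing `0`. -/
def oddSwap : Equiv.Perm ℕ := oddSwap_involutive.toPerm

lemma evenSwap_apply (i : ℕ) : evenSwap i = if i % 2 = 0 then i + 1 else i - 1 := rfl

lemma oddSwap_apply (i : ℕ) :
    oddSwap i = if i = 0 then 0 else if i % 2 = 1 then i + 1 else i - 1 := rfl

lemma memℓp_geometric {q : ℝ} (hq0 : 0 ≤ q) (hq1 : q < 1) :
    Memℓp (fun i : ℕ => q ^ i) (2 : ENNReal) := by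
  have h2 : 0 < (2 : ENNReal).toReal := by norm_num
  rw [memℓp_gen_iff h2]
  have : (fun i : ℕ => ‖q ^ i‖ ^ (2 : ENNReal).toReal) = fun i => (q ^ 2) ^ i := by
    funext i
    rw [ENNReal.toReal_ofNat, Real.rpow_ofNat, Real.norm_eq_abs, sq_abs]; ring
  rw [this]
  exact summable_geometric_of_lt_one (sq_nonneg q) (by nlinarith)

/-- The vector `(1, q, q², …)` of `ℓ₂`. -/
noncomputable def geomVec (q : ℝ) (hq0 : 0 ≤ q) (hq1 : q < 1) : EllTwo :=
  ⟨fun i => q ^ i, memℓp_geometric hq0 hq1⟩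

lemma geomVec_apply (q : ℝ) (hq0 : 0 ≤ q) (hq1 : q < 1) (i : ℕ) : geomVec q hq0 hq1 i = q ^ i := rfl

lemma ellTwo_hasSum_sq (x : EllTwo) : HasSum (fun i => x i ^ 2) (‖x‖ ^ 2) := by
  have h := lp.hasSum_inner (𝕜 := ℝ) x x
  rw [real_inner_self_eq_norm_sq] at h
  simpa only [real_inner_self_eq_norm_sq, Real.norm_eq_abs, sq_abs] using h

/-- Only the tail beyond `m` is kept; there `x` vanishes and the geometric vector is `q ^ m` times a
copy of itself. -/
lemma dist_geomVec_ge (q : ℝ) (hq0 : 0 ≤ q) (hq1 : q < 1) {m : ℕ} {x : EllTwo}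
    (hx : x ∈ headSpace m) :
    q ^ (2 * m) * ‖geomVec q hq0 hq1‖ ^ 2 ≤ ‖x - geomVec q hq0 hq1‖ ^ 2 := by
  have h1 := (ellTwo_hasSum_sq (geomVec q hq0 hq1)).mul_left (q ^ (2 * m))
  have h2 := ellTwo_hasSum_sq (x - geomVec q hq0 hq1)
  rw [← h1.tsum_eq, ← h2.tsum_eq, ← h2.summable.sum_add_tsum_nat_add m]
  have e : ∀ i, (x - geomVec q hq0 hq1 : EllTwo) (i + m) ^ 2
      = q ^ (2 * m) * geomVec q hq0 hq1 i ^ 2 := by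
    intro i
    change (x (i + m) - q ^ (i + m)) ^ 2 = q ^ (2 * m) * (q ^ i) ^ 2
    rw [hx (i + m) (by omega)]; ring
  rw [tsum_congr e]
  have : 0 ≤ ∑ i ∈ Finset.range m, (x - geomVec q hq0 hq1 : EllTwo) i ^ 2 :=
    Finset.sum_nonneg fun _ _ => sq_nonneg _
  linarith

/-! ### The sweep of the bridge and the spread of information -/

/-- The triangle wave `1, 2, …, T, T, …, 2, 1, 1, 2, …`. -/
def wave (T t : ℕ) : ℕ := if t / T % 2 = 0 then t % T + 1 else T - t % T

/-- A bound for the number of coordinates known to node `i ≤ T + 1` when the clock shows `t`. -/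
def level (T t i : ℕ) : ℕ :=
  t / T + if (t / T % 2 = 0 ∧ i ≤ t % T) ∨ (t / T % 2 = 1 ∧ T + 1 ≤ i + t % T) then 1 else 0

lemma div_mod_succ {T : ℕ} (hT : 0 < T) (t : ℕ) :
    ((t + 1) / T = t / T ∧ (t + 1) % T = t % T + 1 ∧ t % T + 1 < T) ∨
      ((t + 1) / T = t / T + 1 ∧ (t + 1) % T = 0 ∧ t % T + 1 = T) := by
  have h1 := Nat.div_add_mod t T
  have h2 := Nat.mod_lt t hT
  rcases Nat.lt_or_ge (t % T + 1) T with h | h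
  · left
    have e : t + 1 = (t % T + 1) + T * (t / T) := by omega
    refine ⟨?_, ?_, h⟩
    · conv_lhs => rw [e, Nat.add_mul_div_left _ _ hT, Nat.div_eq_of_lt h, zero_add]
    · conv_lhs => rw [e, Nat.add_mul_mod_self_left, Nat.mod_eq_of_lt h]
  · right
    have e : t + 1 = T * (t / T + 1) := by rw [mul_add]; omega
    refine ⟨?_, ?_, by omega⟩
    · conv_lhs => rw [e, Nat.mul_div_cancel_left _ hT]
    · conv_lhs => rw [e, Nat.mul_mod_right]

lemma wave_le {T : ℕ} (hT : 0 < T) (t : ℕ) : wave T t ≤ T := by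
  have := Nat.mod_lt t hT
  unfold wave; split_ifs <;> omega

lemma wave_succ {T : ℕ} (hT : 0 < T) (t : ℕ) :
    wave T (t + 1) ≤ wave T t + 1 ∧ wave T t ≤ wave T (t + 1) + 1 := by
  have := Nat.mod_lt t hT
  unfold wave
  rcases div_mod_succ hT t with ⟨h1, h2, h3⟩ | ⟨h1, h2, h3⟩ <;> rw [h1, h2] <;>
    split_ifs <;> omega

/-- With `level_last`, this parity makes the local oracles harmless: the pairing at the first node
preserves initial segments of odd length, the one at the last node those of even length. -/
lemma level_first {T : ℕ} (hT : 0 < T) (t : ℕ) : level T t 0 % 2 = 1 := by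
  have := Nat.mod_lt t hT
  unfold level; split_ifs <;> omega

lemma level_last {T : ℕ} (hT : 0 < T) (t : ℕ) : level T t (T + 1) % 2 = 0 := by
  have := Nat.mod_lt t hT
  unfold level; split_ifs <;> omega

lemma level_le (T t i : ℕ) : level T t i ≤ t / T + 1 := by
  unfold level; split_ifs <;> omega

/-- In a sweep the better informed nodes are exactly those behind the bridge. A message can take
their knowledge at most to the bridge itself, which is behind the next position one tick later. At a
turn the base level rises for all nodes, and only the end node is one ahead. -/
lemma level_step {T : ℕ} (hT : 0 < T) (t i j : ℕ)
    (h : i = j ∨ (¬ (j < wave T t ∧ wave T t < i) ∧ ¬ (i < wave T t ∧ wave T t < j))) :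
    level T t j ≤ level T (t + 1) i := by
  have := Nat.mod_lt t hT
  unfold level
  unfold wave at h
  rcases div_mod_succ hT t with ⟨h1, h2, h3⟩ | ⟨h1, h2, h3⟩
  · rw [h1, h2]; split_ifs at h ⊢ <;> omega
  · rw [h1, h2]; split_ifs at h ⊢ <;> omega

lemma level_mono {T : ℕ} (hT : 0 < T) (i : ℕ) : Monotone fun t => level T t i :=
  monotone_nat_of_le_succ fun t => level_step hT t i i (Or.inl rfl)

/-! ### The local objectives and the problem -/

/-- The coupling strength of node `i` of `n`. -/
noncomputable def nodeCoupling (n : ℕ) (β : ℝ) (i : Fin n) : ℝ :=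
  if (i : ℕ) = 0 ∨ (i : ℕ) + 1 = n then n * β else 0

/-- The pairing of the coordinates at node `i`. -/
def nodePerm {n : ℕ} (i : Fin n) : Equiv.Perm ℕ := if (i : ℕ) = 0 then oddSwap else evenSwap

/-- The linear part of the objective at node `i`. -/
noncomputable def nodeVec (n : ℕ) (γ : ℝ) (i : Fin n) : EllTwo :=
  if (i : ℕ) = 0 then (n : ℝ) • lp.single 2 0 γ else 0

/-- The objective of node `i`: a chain quadratic is split into the pairs `(2j + 1, 2j + 2)` at the
first node and `(2j, 2j + 1)` at the last node; all others hold `μ / 2 ‖x‖²`. -/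
noncomputable def nodeFun (n : ℕ) (μ β γ : ℝ) (i : Fin n) : EllTwo → ℝ :=
  quad (mixOp (μ + nodeCoupling n β i) (nodeCoupling n β i) (nodePerm i)) (nodeVec n γ i) 0

lemma nodePerm_involutive {n : ℕ} (i : Fin n) : Function.Involutive (nodePerm i) := by
  unfold nodePerm
  split_ifs
  · exact oddSwap_involutive
  · exact evenSwap_involutive

lemma nodeCoupling_nonneg (n : ℕ) {β : ℝ} (hβ : 0 ≤ β) (i : Fin n) : 0 ≤ nodeCoupling n β i := by
  unfold nodeCoupling
  split_ifs <;> positivity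

/-- The problem with the objectives `nodeFun` on the trees `bridgeGraph`, whose bridge sweeps back
and forth between the two ends. -/
noncomputable def sweepProblem (T : ℕ) (hT : 0 < T) (μ β γ : ℝ) (hμ : 0 < μ) (hβ : 0 ≤ β) :
    DecentralizedProblem (T + 2) where
  graph t := bridgeGraph ⟨wave T t, by have := wave_le hT t; omega⟩
  connected _ := bridgeGraph_connected _
  f := nodeFun (T + 2) μ β γ
  convex i := by
    have := nodeCoupling_nonneg (T + 2) hβ i
    exact quad_convexOn (mixOp_isSelfAdjOp _ _ (nodePerm_involutive i)) _ _
      (mixOp_inner_nonneg this (by linarith) _)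
  smooth i := ⟨_, quad_isSmooth (mixOp_isSelfAdjOp _ _ (nodePerm_involutive i)) _ _ le_rfl⟩
  conj i := by
    have := nodeCoupling_nonneg (T + 2) hβ i
    exact quad_hasRegularConjugate (mixOp_isSelfAdjOp _ _ (nodePerm_involutive i))
      (mixOp_isSelfAdjOp _ _ (nodePerm_involutive i)) _ _
      (mixOp_inner_nonneg this (by linarith) _)
      (mixOp_inverse this (by linarith) (nodePerm_involutive i))

lemma single_mem_headSpace {m : ℕ} (hm : 1 ≤ m) (γ : ℝ) :
    (lp.single 2 0 γ : EllTwo) ∈ headSpace m := fun j hj => by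
  rw [lp.single_apply, Pi.single_eq_of_ne (by omega)]

/-! ### Executions, edge changes and condition number of the problem -/

section Run

variable {T : ℕ} {hT : 0 < T} {μ β γ : ℝ} {hμ : 0 < μ} {hβ : 0 ≤ β}

lemma sweepProblem_oracle (t : ℕ) (i : Fin (T + 2)) {x : EllTwo}
    (hx : x ∈ headSpace (level T t i)) :
    gradient ((sweepProblem T hT μ β γ hμ hβ).f i) x ∈ headSpace (level T t i) ∧
      gradient (fenchelConj ((sweepProblem T hT μ β γ hμ hβ).f i)) x
        ∈ headSpace (level T t i) := by
  have hc := nodeCoupling_nonneg (T + 2) hβ i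
  refine oracle_mem_headSpace hc (by linarith) (nodePerm_involutive i) ?_ ?_ hx
  · by_cases h0 : (i : ℕ) = 0
    · right
      intro j hj
      have := level_first hT t
      rw [← h0] at this
      simp only [nodePerm, if_pos h0, oddSwap_apply]
      split_ifs <;> omega
    by_cases h1 : (i : ℕ) + 1 = T + 2
    · right
      intro j hj
      have := level_last hT t
      rw [← show (i : ℕ) = T + 1 by omega] at this
      simp only [nodePerm, if_neg h0, evenSwap_apply]
      split_ifs <;> omega
    · left
      exact if_neg (not_or.2 ⟨h0, h1⟩)
  · unfold nodeVec
    split_ifs with h0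
    · refine Submodule.smul_mem _ _ (single_mem_headSpace ?_ γ)
      have := level_first hT t
      rw [← h0] at this
      omega
    · exact Submodule.zero_mem _

/-- The hypotheses on `clock` cover both conventions: ticks during local computation are harmless
since levels only grow, and each communication round must make exactly one tick. -/
lemma sweepProblem_run_subset {comm : ℕ → Bool} {clock : ℕ → ℕ}
    {H : ℕ → Fin (T + 2) → Set EllTwo}
    (hrun : IsFirstOrderRun (sweepProblem T hT μ β γ hμ hβ) comm clock H)
    (hmono : ∀ k, clock k ≤ clock (k + 1))
    (hcomm : ∀ k, comm k = true → clock (k + 1) = clock k + 1) (k : ℕ) :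
    ∀ i, H k i ⊆ headSpace (level T (clock k) i) := by
  induction k with
  | zero =>
    intro i
    rw [hrun.init i, Set.singleton_subset_iff]
    exact Submodule.zero_mem _
  | succ k ih =>
    intro i
    cases hc : comm k with
    | false =>
      refine (hrun.compute k hc i).trans ?_
      have hle := headSpace_mono (level_mono hT i (hmono k))
      refine SetLike.coe_subset_coe.2 ((Submodule.span_le.2 ?_).trans hle)
      refine Set.iUnion₂_subset fun x hx => ?_
      have hx' := ih i hx
      have := sweepProblem_oracle (hT := hT) (γ := γ) (hμ := hμ) (hβ := hβ) (clock k) i hx'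
      rintro y (rfl | rfl | rfl)
      · exact hx'
      · exact this.1
      · exact this.2
    | true =>
      refine (hrun.communicate k hc i).trans ?_
      refine SetLike.coe_subset_coe.2 (Submodule.span_le.2 ?_)
      refine Set.iUnion₂_subset fun j hj => (ih j).trans ?_
      rw [hcomm k hc]
      refine SetLike.coe_subset_coe.2 (headSpace_mono (level_step hT _ _ _ ?_))
      rcases hj with hj | hj
      · right
        constructor
        · rintro ⟨h1, h2⟩
          exact bridgeGraph_not_adj (Fin.lt_def.2 h1) (Fin.lt_def.2 h2) hj
        · rintro ⟨h1, h2⟩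
          exact bridgeGraph_not_adj (Fin.lt_def.2 h1) (Fin.lt_def.2 h2) hj.symm
      · exact Or.inl (congrArg Fin.val hj.symm)

lemma sweepProblem_edgeChange_le (t : ℕ) :
    (sweepProblem T hT μ β γ hμ hβ).edgeChange t ≤ 8 :=
  bridgeGraph_edgeChange_le _ _ (wave_succ hT t).1 (wave_succ hT t).2

lemma sweepProblem_maxEdgeChange_le :
    (sweepProblem T hT μ β γ hμ hβ).maxEdgeChange ≤ 8 :=
  ciSup_le fun t => sweepProblem_edgeChange_le t

lemma sweepProblem_graphChi_le (t : ℕ) :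
    graphChi ((sweepProblem T hT μ β γ hμ hβ).graph t) ≤ 192 * ((T : ℝ) + 2) := by
  have := bridge_graphChi_le (n := T + 2) ⟨wave T t, by have := wave_le hT t; omega⟩
  push_cast at this
  exact this

lemma sweepProblem_chi_le : (sweepProblem T hT μ β γ hμ hβ).chi ≤ 192 * ((T : ℝ) + 2) :=
  ciSup_le fun t => sweepProblem_graphChi_le t

lemma le_sweepProblem_chi {m : ℕ} (hm : 1 ≤ m) (hTm : T = 2 * m - 1) :
    (m : ℝ) / 2 ≤ (sweepProblem T hT μ β γ hμ hβ).chi := by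
  -- At clock `m - 1` the bridge is at the middle label `m` of the `2m + 1` nodes.
  refine le_trans ?_ (le_ciSup ⟨_, Set.forall_mem_range.2 fun t => sweepProblem_graphChi_le t⟩
    (m - 1))
  obtain ⟨j, rfl⟩ : ∃ j, m = j + 1 := ⟨m - 1, by omega⟩
  obtain rfl : T = 2 * j + 1 := by omega
  refine le_bridge_graphChi (m := j + 1) hm _ ?_
  change wave (2 * j + 1) (j + 1 - 1) = j + 1
  rw [Nat.add_sub_cancel]
  unfold wave
  have hj : j < 2 * j + 1 := by omega
  rw [Nat.div_eq_of_lt hj, Nat.mod_eq_of_lt hj, if_pos rfl]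

end Run

/-! ### The chain quadratic and its minimizer -/

/-- The Hessian `μ I + β (2 I - W_odd - W_even)` of the chain quadratic. -/
noncomputable def chainOp (μ β : ℝ) : EllTwo →L[ℝ] EllTwo :=
  mixOp (μ + β) β oddSwap + mixOp β β evenSwap

lemma chainOp_apply (μ β : ℝ) (x : EllTwo) :
    chainOp μ β x = mixOp (μ + β) β oddSwap x + mixOp β β evenSwap x := rfl

lemma chainOp_isSelfAdjOp (μ β : ℝ) : IsSelfAdjOp (chainOp μ β) := fun x y => by
  rw [chainOp_apply, chainOp_apply, inner_add_left, inner_add_right,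
    mixOp_isSelfAdjOp _ _ oddSwap_involutive x y, mixOp_isSelfAdjOp _ _ evenSwap_involutive x y]

lemma mixOp_norm_le {s t : ℝ} (hs : 0 ≤ s) (ht : 0 ≤ t) (π : Equiv.Perm ℕ) :
    ‖mixOp s t π‖ ≤ s + t := by
  refine (norm_sub_le _ _).trans (add_le_add ?_ ?_)
  · rw [norm_smul, Real.norm_of_nonneg hs]
    exact mul_le_of_le_one_right hs ContinuousLinearMap.norm_id_le
  · rw [norm_smul, Real.norm_of_nonneg ht]
    exact mul_le_of_le_one_right ht (permOp_norm_le π)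

lemma chainOp_norm_le {μ β : ℝ} (hμ : 0 ≤ μ) (hβ : 0 ≤ β) : ‖chainOp μ β‖ ≤ μ + 4 * β := by
  refine (norm_add_le _ _).trans ?_
  have h1 := mixOp_norm_le (add_nonneg hμ hβ) hβ oddSwap
  have h2 := mixOp_norm_le hβ hβ evenSwap
  linarith

lemma le_chainOp_inner (μ : ℝ) {β : ℝ} (hβ : 0 ≤ β) (x : EllTwo) :
    μ * ‖x‖ ^ 2 ≤ inner ℝ (chainOp μ β x) x := by
  have h1 := mixOp_inner_nonneg hβ le_rfl oddSwap x
  have h2 := mixOp_inner_nonneg hβ le_rfl evenSwap x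
  have h3 : inner ℝ (mixOp (μ + β) β oddSwap x) x
      = μ * ‖x‖ ^ 2 + inner ℝ (mixOp β β oddSwap x) x := by
    simp only [mixOp_apply, inner_sub_left, real_inner_smul_left, real_inner_self_eq_norm_sq]
    ring
  rw [chainOp_apply, inner_add_left]
  linarith

/-- In each row `j ≥ 1` the two pairings together reach both neighbours of `j`, giving a three-term
recurrence with characteristic equation `hq`. In row `0`, fixed by `oddSwap`, the boundary value
remains. -/
lemma chainOp_geomVec {μ β q : ℝ} (hq0 : 0 ≤ q) (hq1 : q < 1)
    (hq : β * (1 - q) ^ 2 = μ * q) :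
    chainOp μ β (geomVec q hq0 hq1) = lp.single 2 0 (μ + β * (1 - q)) := by
  ext j
  rw [lp.single_apply]
  change ((μ + β) * q ^ j - β * q ^ (oddSwap j)) + (β * q ^ j - β * q ^ (evenSwap j)) = _
  rw [oddSwap_apply, evenSwap_apply]
  rcases Nat.eq_zero_or_pos j with rfl | hj
  · simp; ring
  · rw [Pi.single_eq_of_ne (by omega)]
    obtain ⟨k, rfl⟩ : ∃ k, j = k + 1 := ⟨j - 1, by omega⟩
    have : (μ + β) * q ^ (k + 1) + β * q ^ (k + 1) - β * q ^ (k + 2) - β * q ^ k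
        = q ^ k * (μ * q - β * (1 - q) ^ 2) := by ring
    rw [hq, sub_self, mul_zero] at this
    rcases Nat.mod_two_eq_zero_or_one (k + 1) with h | h
    · rw [if_neg (by omega), if_neg (by omega), if_pos h, Nat.add_sub_cancel]
      linarith
    · rw [if_neg (by omega), if_pos h, if_neg (by omega), Nat.add_sub_cancel]
      linarith

lemma sweepProblem_globalFun {T : ℕ} (hT : 0 < T) (μ β γ : ℝ) (hμ : 0 < μ) (hβ : 0 ≤ β) :
    (sweepProblem T hT μ β γ hμ hβ).globalFun = quad (chainOp μ β) (lp.single 2 0 γ) 0 := by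
  funext x
  set N : ℝ := ((T + 2 : ℕ) : ℝ) with hN
  have hN0 : N ≠ 0 := by rw [hN]; positivity
  set u := inner ℝ x x with hu
  set wo := inner ℝ (permOp oddSwap x) x with hwo
  set we := inner ℝ (permOp evenSwap x) x with hwe
  set bx := inner ℝ (lp.single 2 0 γ : EllTwo) x with hbx
  have hnode : ∀ i : Fin (T + 2), nodeFun (T + 2) μ β γ i x = μ / 2 * u
      + (if i = 0 then N * (β / 2 * (u - wo) - bx) else 0)
      + (if i = Fin.last (T + 1) then N * (β / 2 * (u - we)) else 0) := by
    intro i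
    by_cases h0 : (i : ℕ) = 0
    · have e0 : i = 0 := Fin.ext h0
      have e1 : i ≠ Fin.last (T + 1) := fun h => by rw [h, Fin.val_last] at h0; omega
      simp only [nodeFun, nodeCoupling, nodePerm, nodeVec, quad, if_pos h0, if_pos e0, if_neg e1,
        if_pos (Or.inl h0 : (i : ℕ) = 0 ∨ (i : ℕ) + 1 = T + 2), mixOp_apply, inner_sub_left,
        real_inner_smul_left, ← hu, ← hwo, ← hbx, ← hN]
      ring
    · have e0 : i ≠ 0 := fun h => h0 (by rw [h]; rfl)
      by_cases h1 : (i : ℕ) + 1 = T + 2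
      · have e1 : i = Fin.last (T + 1) := Fin.ext (by rw [Fin.val_last]; omega)
        simp only [nodeFun, nodeCoupling, nodePerm, nodeVec, quad, if_neg h0, if_neg e0, if_pos e1,
          if_pos (Or.inr h1 : (i : ℕ) = 0 ∨ (i : ℕ) + 1 = T + 2), mixOp_apply, inner_sub_left,
          real_inner_smul_left, ← hu, ← hwe, ← hN, inner_zero_left]
        ring
      · have e1 : i ≠ Fin.last (T + 1) := fun h => by rw [h, Fin.val_last] at h1; omega
        simp only [nodeFun, nodeCoupling, nodePerm, nodeVec, quad, if_neg h0, if_neg e0, if_neg e1,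
          if_neg (not_or.2 ⟨h0, h1⟩ : ¬ ((i : ℕ) = 0 ∨ (i : ℕ) + 1 = T + 2)), mixOp_apply,
          inner_sub_left, real_inner_smul_left, ← hu, inner_zero_left]
        ring
  have hsum : ∑ i, nodeFun (T + 2) μ β γ i x = N * (μ / 2 * u)
      + N * (β / 2 * (u - wo) - bx) + N * (β / 2 * (u - we)) := by
    rw [Finset.sum_congr rfl fun i _ => hnode i, Finset.sum_add_distrib, Finset.sum_add_distrib,
      Finset.sum_ite_eq', Finset.sum_ite_eq', Finset.sum_const, Finset.card_univ, Fintype.card_fin,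
      nsmul_eq_mul, if_pos (Finset.mem_univ _), if_pos (Finset.mem_univ _)]
  change 1 / N * ∑ i, nodeFun (T + 2) μ β γ i x = _
  rw [hsum]
  simp only [quad, chainOp_apply, mixOp_apply, inner_add_left, inner_sub_left,
    real_inner_smul_left, ← hu, ← hwo, ← hwe, ← hbx]
  field_simp
  ring

/-! ### Rates and numerical constants -/

/-- The ratio `(√κ - 1) / (√κ + 1)` for `κ = L / μ`. -/
noncomputable def chainRatio (L μ : ℝ) : ℝ := (1 - √(μ / L)) / (1 + √(μ / L))

section Ratio

variable {L μ : ℝ}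

lemma sqrt_ratio_pos (hμ : 0 < μ) (hL : μ ≤ L) : 0 < √(μ / L) :=
  Real.sqrt_pos.2 (div_pos hμ (hμ.trans_le hL))

lemma sqrt_ratio_le_one (hμ : 0 < μ) (hL : μ ≤ L) : √(μ / L) ≤ 1 :=
  Real.sqrt_le_one.2 ((div_le_one (hμ.trans_le hL)).2 hL)

lemma chainRatio_nonneg (hμ : 0 < μ) (hL : μ ≤ L) : 0 ≤ chainRatio L μ :=
  div_nonneg (sub_nonneg.2 (sqrt_ratio_le_one hμ hL)) (by positivity)

lemma chainRatio_lt_one (hμ : 0 < μ) (hL : μ ≤ L) : chainRatio L μ < 1 := by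
  have := sqrt_ratio_pos hμ hL
  rw [chainRatio, div_lt_one (by positivity)]
  linarith

lemma chainRatio_eq (hμ : 0 < μ) (hL : μ ≤ L) :
    (L - μ) / 4 * (1 - chainRatio L μ) ^ 2 = μ * chainRatio L μ := by
  have hs := sqrt_ratio_pos hμ hL
  have hL0 : 0 < L := hμ.trans_le hL
  have hsq : √(μ / L) ^ 2 = μ / L := Real.sq_sqrt (by positivity)
  unfold chainRatio
  set s := √(μ / L)
  have hm : μ = L * s ^ 2 := by rw [hsq]; field_simp
  have h1 : 1 + s ≠ 0 := by positivity
  rw [hm]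
  field_simp
  ring

/-- With `s = √(μ / L)` one has `(1 - s) / (1 + s) ≥ 1 - 2 s`, and `√10 ≥ 2`. -/
lemma max_rate_le_chainRatio (hμ : 0 < μ) (hL : μ ≤ L) :
    max 0 (1 - √10 * √(μ / L)) ≤ chainRatio L μ := by
  have hs := sqrt_ratio_pos hμ hL
  refine max_le (chainRatio_nonneg hμ hL) ?_
  unfold chainRatio
  set s := √(μ / L)
  rw [le_div_iff₀ (by positivity)]
  have h10 : (2 : ℝ) ≤ √10 := Real.le_sqrt_of_sq_le (by norm_num)
  nlinarith [mul_le_mul_of_nonneg_right h10 hs.le, mul_pos hs hs]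

lemma rateBound_le_chainRatio_pow (hμ : 0 < μ) (hL : μ ≤ L) {χ : ℝ} {T p l : ℕ} (hT : 2 ≤ T)
    (hχ : 2 ^ 65 ≤ χ) (hχT : χ ≤ 192 * ((T : ℝ) + 2)) (hl : l ≤ p / T + 1) :
    rateBound L μ χ p ≤ chainRatio L μ ^ (2 * l) := by
  have h0 : 0 ≤ max 0 (1 - √10 * √(μ / L)) := le_max_left _ _
  have h1 := max_rate_le_chainRatio hμ hL
  have h2 := (h1.trans (chainRatio_lt_one hμ hL).le)
  have hχ0 : 0 < χ := lt_of_lt_of_le (by norm_num) hχ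
  have hT0 : (0 : ℝ) < T := by positivity
  have hT2 : (2 : ℝ) ≤ T := by exact_mod_cast hT
  have hlog : 64 ≤ Real.logb 2 (χ / 2) := by
    rw [Real.le_logb_iff_rpow_le (by norm_num) (by positivity)]
    have : (2 : ℝ) ^ (64 : ℝ) = 2 ^ 64 := by norm_cast
    rw [this]; linarith
  have hlr : (l : ℝ) ≤ p / T + 1 := by
    have : (l : ℝ) ≤ ((p / T + 1 : ℕ) : ℝ) := by exact_mod_cast hl
    push_cast at this
    linarith [Nat.cast_div_le (α := ℝ) (m := p) (n := T)]
  have hexp : ((2 * l : ℕ) : ℝ) ≤ 12 * Real.logb 2 (χ / 2) * (p : ℝ) / χ + 2 := by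
    have hp0 : (0 : ℝ) ≤ p := Nat.cast_nonneg p
    -- Since `T ≥ 2`, `χ ≤ 384 T`, and `χ ≥ 2 ^ 65` makes the logarithm at least `64`; then `12 * 64
    -- = 2 * 384` suffices.
    have : 2 * ((p : ℝ) / T) ≤ 12 * Real.logb 2 (χ / 2) * (p : ℝ) / χ := by
      rw [mul_div_assoc', div_le_div_iff₀ hT0 hχ0]
      have a1 : χ ≤ 384 * (T : ℝ) := by linarith
      have a2 : 2 * (p : ℝ) * χ ≤ 2 * p * (384 * T) := by gcongr
      have a3 : 12 * 64 * ((p : ℝ) * T) ≤ 12 * Real.logb 2 (χ / 2) * (p * T) := by gcongr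
      linarith
    push_cast; linarith
  calc rateBound L μ χ p ≤ (max 0 (1 - √10 * √(μ / L))) ^ ((2 * l : ℕ) : ℝ) :=
        Real.rpow_le_rpow_of_exponent_ge' h0 h2 (Nat.cast_nonneg _) hexp
    _ = (max 0 (1 - √10 * √(μ / L))) ^ (2 * l) := Real.rpow_natCast _ _
    _ ≤ _ := pow_le_pow_left₀ h0 h1 _

/-- Taking logarithms bounds `l`, hence `p / T + 1`, from below by a multiple of `√κ log (1 / ε)`.
The condition `κ ≥ κ₀ > 1` keeps `q` away from `0`, and the smallness of `ε` absorbs the `+ 1`. -/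
lemma rounds_ge_of_chainRatio_pow_le {κ₀ : ℝ} (hκ₀ : 1 < κ₀) (hμ : 0 < μ) (hL : μ ≤ L)
    (hκ : κ₀ ≤ L / μ) {χ : ℝ} {T p l : ℕ} (hT : 2 ≤ T) (hχ : 2 ^ 65 ≤ χ)
    (hχT : χ ≤ 192 * ((T : ℝ) + 2)) (hl : l ≤ p / T + 1) {ε : ℝ} (hε : 0 < ε)
    (hε₀ : ε ≤ Real.exp (-(8 / (1 - √(1 / κ₀))))) (hq : chainRatio L μ ^ (2 * l) ≤ ε) :
    (1 - √(1 / κ₀)) / 3072 * (χ / Real.log χ * √(L / μ) * Real.log (1 / ε)) ≤ (p : ℝ) := by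
  have hL0 : 0 < L := hμ.trans_le hL
  have hs := sqrt_ratio_pos hμ hL
  have hs1 := sqrt_ratio_le_one hμ hL
  have hχ0 : 0 < χ := lt_of_lt_of_le (by norm_num) hχ
  have hT0 : (0 : ℝ) < T := by positivity
  have hT2 : (2 : ℝ) ≤ T := by exact_mod_cast hT
  have hlr : (l : ℝ) ≤ p / T + 1 := by
    have : (l : ℝ) ≤ ((p / T + 1 : ℕ) : ℝ) := by exact_mod_cast hl
    push_cast at this
    linarith [Nat.cast_div_le (α := ℝ) (m := p) (n := T)]
  have hs0 : √(1 / κ₀) < 1 := by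
    rw [Real.sqrt_lt' one_pos, one_pow, div_lt_one (by linarith)]; exact hκ₀
  have hss0 : √(μ / L) ≤ √(1 / κ₀) := by
    apply Real.sqrt_le_sqrt
    rw [div_le_div_iff₀ hL0 (by linarith), one_mul]
    rw [le_div_iff₀ hμ] at hκ
    linarith
  have hinv : √(L / μ) = 1 / √(μ / L) := by
    rw [one_div, ← Real.sqrt_inv, inv_div]
  have hqpos : 0 < chainRatio L μ := div_pos (by linarith) (by linarith)
  have hlogq : -Real.log (chainRatio L μ) ≤ 2 * √(μ / L) / (1 - √(1 / κ₀)) := by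
    rw [← Real.log_inv]
    refine (Real.log_le_sub_one_of_pos (inv_pos.2 hqpos)).trans ?_
    have h1 : 0 < 1 - √(μ / L) := by linarith
    have h2 : (1 : ℝ) + √(μ / L) ≠ 0 := by positivity
    have : (chainRatio L μ)⁻¹ - 1 = 2 * √(μ / L) / (1 - √(μ / L)) := by
      rw [chainRatio]; field_simp; ring
    rw [this]
    exact div_le_div_of_nonneg_left (by positivity) (by linarith) (by linarith)
  rw [hinv, one_div ε, Real.log_inv]
  set s := √(μ / L)
  set D := 1 - √(1 / κ₀)
  have hD : 0 < D := by simp only [D]; linarith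
  have hD1 : D ≤ 1 := by simp only [D]; linarith [Real.sqrt_nonneg (1 / κ₀)]
  have hlogε : -Real.log ε ≤ 2 * l * (2 * s / D) := by
    have := Real.log_le_log (pow_pos hqpos _) hq
    rw [Real.log_pow] at this
    push_cast at this
    have h2 : 2 * (l : ℝ) * -Real.log (chainRatio L μ) ≤ 2 * l * (2 * s / D) := by gcongr
    linarith
  have hbig : 8 / D ≤ -Real.log ε := by
    have := Real.log_le_log hε hε₀
    rw [Real.log_exp] at this
    linarith
  set W := -Real.log ε
  have hW8 : 8 ≤ W * D := by rwa [div_le_iff₀ hD] at hbig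
  have hW0 : 0 < W := lt_of_lt_of_le (by positivity) hbig
  have hWs : W * D ≤ 4 * l * s := by
    have : 2 * (l : ℝ) * (2 * s / D) = 4 * l * s / D := by ring
    rw [this, le_div_iff₀ hD] at hlogε
    exact hlogε
  -- As `s ≤ 1` and `W D ≥ 8`, the extra `4 s` is at most `W D / 2`. This costs a factor two, and
  -- `3072 = 8 * 384` in the final constant.
  have hp : T * (W * D / (8 * s)) ≤ (p : ℝ) := by
    have h1 : W * D ≤ 4 * (p / T + 1) * s := hWs.trans (by gcongr)
    have h2 : W * D / (8 * s) ≤ p / T := by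
      rw [div_le_iff₀ (by positivity)]
      nlinarith
    rw [le_div_iff₀ hT0] at h2
    linarith
  have hlogχ : 1 ≤ Real.log χ := by
    rw [Real.le_log_iff_exp_le hχ0]
    have := Real.exp_one_lt_d9
    linarith
  have hχlog : χ / Real.log χ ≤ 384 * T := by
    have : χ / Real.log χ ≤ χ := div_le_self hχ0.le hlogχ
    linarith
  calc D / 3072 * (χ / Real.log χ * (1 / s) * W) ≤ D / 3072 * (384 * T * (1 / s) * W) := by gcongr
    _ = T * (W * D / (8 * s)) := by field_simp; ring
    _ ≤ p := hp

end Ratio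

/-! ### The theorem -/

lemma roundCount_succ (comm : ℕ → Bool) (k : ℕ) :
    roundCount comm (k + 1) = roundCount comm k + if comm k = true then 1 else 0 :=
  Nat.count_succ _ _

theorem theorem2 (κ₀ : ℝ) (hκ₀ : 1 < κ₀) :
    ∃ c : ℝ, 0 < c ∧ ∃ ε₀ : ℝ, 0 < ε₀ ∧ ε₀ < 1 ∧
      ∀ L μ M : ℝ, 0 < μ → μ ≤ L → 10 < L →
        ∃ (n : ℕ) (P : DecentralizedProblem n) (xstar : EllTwo),
          IsSmooth L P.globalFun ∧ IsStronglyConvex μ P.globalFun ∧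
          M < (n : ℝ) ∧ M < P.chi ∧
          (P.maxEdgeChange : ℝ) ≤ 12 * Real.logb 2 (n : ℝ) ∧
          IsMinOn P.globalFun Set.univ xstar ∧ xstar ≠ 0 ∧
          -- the graph changes at every time step, `p` is the number of time steps
          (∀ (comm : ℕ → Bool) (H : ℕ → Fin n → Set EllTwo),
            IsFirstOrderRun P comm (fun k => k) H →
            ∀ (p : ℕ) (i : Fin n), ∀ x ∈ H p i,
              rateBound L μ P.chi p * ‖0 - xstar‖ ^ 2 ≤ ‖x - xstar‖ ^ 2) ∧
          -- the graph changes at every communication round, `p` is the number of such rounds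
          (∀ (comm : ℕ → Bool) (H : ℕ → Fin n → Set EllTwo),
            IsFirstOrderRun P comm (roundCount comm) H →
            ∀ (k : ℕ) (i : Fin n), ∀ x ∈ H k i,
              rateBound L μ P.chi (roundCount comm k) * ‖0 - xstar‖ ^ 2 ≤ ‖x - xstar‖ ^ 2) ∧
          -- the communication complexity
          (κ₀ ≤ L / μ →
            ∀ (comm : ℕ → Bool) (H : ℕ → Fin n → Set EllTwo),
              IsFirstOrderRun P comm (roundCount comm) H →
              ∀ ε : ℝ, 0 < ε → ε ≤ ε₀ →
                ∀ (k : ℕ) (i : Fin n), ∀ x ∈ H k i,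
                  ‖x - xstar‖ ^ 2 ≤ ε * ‖0 - xstar‖ ^ 2 →
                  c * (P.chi / Real.log P.chi * √(L / μ) * Real.log (1 / ε)) ≤
                    (roundCount comm k : ℝ)) := by
  have hs0 : √(1 / κ₀) < 1 := by
    rw [Real.sqrt_lt' one_pos, one_pow, div_lt_one (by linarith)]; exact hκ₀
  refine ⟨(1 - √(1 / κ₀)) / 3072, by apply div_pos <;> linarith,
    Real.exp (-(8 / (1 - √(1 / κ₀)))), Real.exp_pos _, ?_, ?_⟩
  · rw [Real.exp_lt_one_iff, neg_lt_zero]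
    apply div_pos <;> linarith
  intro L μ M hμ hL _
  -- Since `χ ≥ m / 2`, this choice makes `χ` exceed both `M` and `2 ^ 65`.
  obtain ⟨m, hm⟩ := exists_nat_gt (2 * max M (2 ^ 65))
  have hmM : 2 * M < m := lt_of_le_of_lt (by gcongr; exact le_max_left _ _) hm
  have hm65 : 2 * (2 : ℝ) ^ 65 < m := lt_of_le_of_lt (by gcongr; exact le_max_right _ _) hm
  have hm2 : 2 ≤ m := by
    have : (2 : ℝ) ≤ m := le_trans (by norm_num) hm65.le
    exact_mod_cast this
  obtain ⟨T, hTm⟩ : ∃ T, T = 2 * m - 1 := ⟨_, rfl⟩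
  have hT : 0 < T := by omega
  have hT2 : 2 ≤ T := by omega
  have hmT : (m : ℝ) ≤ T := by exact_mod_cast (by omega : m ≤ T)
  have hβ : 0 ≤ (L - μ) / 4 := by linarith
  set q := chainRatio L μ with hqdef
  have hq0 : 0 ≤ q := chainRatio_nonneg hμ hL
  have hq1 : q < 1 := chainRatio_lt_one hμ hL
  -- The coupling `(L - μ) / 4` gives the Hessian norm at most `L`; the linear coefficient is the
  -- boundary value in `chainOp_geomVec`.
  set P := sweepProblem T hT μ ((L - μ) / 4) (μ + (L - μ) / 4 * (1 - q)) hμ hβ with hP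
  have hglob : P.globalFun = _ := sweepProblem_globalFun hT _ _ _ hμ hβ
  have hself := chainOp_isSelfAdjOp μ ((L - μ) / 4)
  have hstrong := le_chainOp_inner μ hβ
  have hχ1 : (m : ℝ) / 2 ≤ P.chi := le_sweepProblem_chi (by omega) hTm
  have hχ2 : P.chi ≤ 192 * ((T : ℝ) + 2) := sweepProblem_chi_le
  have hχ65 : 2 ^ 65 ≤ P.chi := by linarith
  -- This includes `L = μ`, where `q = 0` and the minimizer is the first unit vector because `0 ^ 0
  -- = 1`.
  have hxs : geomVec q hq0 hq1 ≠ 0 := fun h => by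
    have : geomVec q hq0 hq1 0 = 0 := by rw [h]; rfl
    rw [geomVec_apply, pow_zero] at this
    exact one_ne_zero this
  have hdist : ∀ (l : ℕ) (x : EllTwo), x ∈ headSpace l →
      q ^ (2 * l) * ‖0 - geomVec q hq0 hq1‖ ^ 2 ≤ ‖x - geomVec q hq0 hq1‖ ^ 2 := by
    intro l x hx
    rw [zero_sub, norm_neg]
    exact dist_geomVec_ge q hq0 hq1 hx
  have hround : ∀ (comm : ℕ → Bool) (H : ℕ → Fin (T + 2) → Set EllTwo),
      IsFirstOrderRun P comm (roundCount comm) H → ∀ k i, ∀ x ∈ H k i,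
        x ∈ headSpace (level T (roundCount comm k) i) := by
    intro comm H hrun k i x hx
    exact sweepProblem_run_subset hrun (fun k => by rw [roundCount_succ]; omega)
      (fun k hk => by rw [roundCount_succ, if_pos hk]) k i hx
  refine ⟨T + 2, P, geomVec q hq0 hq1, ?_, ?_, ?_, by linarith, ?_, ?_, hxs, ?_, ?_, ?_⟩
  · rw [hglob]
    exact quad_isSmooth hself _ _ ((chainOp_norm_le hμ.le hβ).trans (by linarith))
  · rw [hglob]
    exact quad_isStronglyConvex hself _ _ hstrong
  · push_cast
    have : (0 : ℝ) ≤ m := Nat.cast_nonneg m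
    linarith
  · have h8 : (P.maxEdgeChange : ℝ) ≤ 8 := by exact_mod_cast sweepProblem_maxEdgeChange_le
    have : 1 ≤ Real.logb 2 ((T + 2 : ℕ) : ℝ) := by
      rw [Real.le_logb_iff_rpow_le (by norm_num) (by positivity), Real.rpow_one]
      push_cast
      linarith [(Nat.cast_nonneg T : (0 : ℝ) ≤ T)]
    linarith
  · rw [hglob]
    exact quad_isMinOn hself _ _ (fun x => le_trans (by positivity) (hstrong x))
      (chainOp_geomVec hq0 hq1 (chainRatio_eq hμ hL))
  · intro comm H hrun p i x hx
    have hmem := sweepProblem_run_subset hrun (fun k => Nat.le_succ k) (fun _ _ => rfl) p i hx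
    refine le_trans ?_ (hdist _ x hmem)
    exact mul_le_mul_of_nonneg_right
      (rateBound_le_chainRatio_pow hμ hL hT2 hχ65 hχ2 (level_le T p i)) (sq_nonneg _)
  · intro comm H hrun k i x hx
    refine le_trans ?_ (hdist _ x (hround comm H hrun k i x hx))
    exact mul_le_mul_of_nonneg_right
      (rateBound_le_chainRatio_pow hμ hL hT2 hχ65 hχ2 (level_le T _ i)) (sq_nonneg _)
  · intro hκ comm H hrun ε hε hε0 k i x hx hxε
    have hpos : 0 < ‖0 - geomVec q hq0 hq1‖ ^ 2 := by
      rw [zero_sub, norm_neg]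
      exact pow_pos (norm_pos_iff.2 hxs) 2
    exact rounds_ge_of_chainRatio_pow_le hκ₀ hμ hL hκ hT2 hχ65 hχ2 (level_le T _ i) hε hε0
      (le_of_mul_le_mul_right ((hdist _ x (hround comm H hrun k i x hx)).trans hxε) hpos)
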